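/- **Model.** A receiver has $K$ antennas with channel coefficients $\tilde h_1,\dots,\tilde h_K$. In the *simplified receiver*, $K_1$ antennas ($1\le K_1<K$; those with index $k\le K_1$) are connected to coherent-detection (CD) circuits and the other $K_2=K-K_1$ to power-detection (PD) circuits. After maximal ratio combining the received signal is $$\tilde Y_1=\sqrt{\Theta_1}\sqrt P\,\tilde X+\tilde Z,\qquad Y_2=\sqrt{\Theta_2}\,P\,|\tilde X|^2+N,\qquad \Theta_1=\sum_{k\le K_1}|\tilde h_k|^2,\quad \Theta_2=\sum_{K_1<k\le K}|\tilde h_k|^4 ,$$ where $\tilde X\sim\mathcal{CN}(0,1)$, $\tilde Z\sim\mathcal{CN}(0,\sigma_1^2)$, $N\sim\mathcal N(0,\sigma_2^2)$ are independent and $\sigma_1,\sigma_2>0$. For a given realization of the channel let $I_K(K_1,P)=\mathcal I(\sqrt P\tilde X;\tilde Y_1,Y_2)$ be the mutual information in bits. For $c>0$ put $$R_{K,c}(K_1,P)=\log_2\frac{\sqrt2\,P^{3/2}\sqrt{K_1K_2\,c}}{\sigma_1\sigma_2}-\frac{\gamma}{2\ln2},\qquad R^\star_{K,c}(P)=\log_2\frac{K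 P^{3/2}\sqrt c}{\sqrt2\,\sigma_1\sigma_2}-\frac{\gamma}{2\ln 2},$$ where $\gamma$ is Euler's constant. Here $4K_1K_2\le K^2$, with equality if and only if $K_1=K/2$, and $R_{K,c}(K/2,P)=R^\star_{K,c}(P)$. Say that *half-half is optimal with constant $c$* if for every $\varepsilon>0$ there is $K_0$ such that for every $K\ge K_0$ there is $P_0$ (which may depend on $K$, $\varepsilon$ and the channel realization) such that for all $P\ge P_0$, with $m=\lfloor K/2\rfloor$: 1. all $I_K(K_1,P)$, $1\le K_1<K$, are finite, $I_K(K_1,P)\le I_K(m,P)+\varepsilon$, and $I_K(K_1,P)<I_K(m,P)$ whenever $|K_1/K-1/2|>\varepsilon$; 2. $|I_K(m,P)-R^\star_{K,c}(P)|\le\varepsilon$; 3. every maximizer $K_1$ of $I_K(\cdot,P)$ over $1\le K_1<K$ satisfies $|K_1/K-1/2|\le\varepsilon$, and the maximum is within $\varepsilon$ of $R^\star_{K,c}(P)$; 4. $|I_K(K_1,P)-R_{K,c}(K_1,P)|\le\varepsilon$ for all $K_1$ with $\varepsilon K\le K_1\le(1-\varepsilon)K$. **Proposition.** (a) (Uncorrelated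 channel.) If $\tilde h_1,\tilde h_2,\dots$ are i.i.d. with $\mathbb E|\tilde h_k|^4<\infty$ and $\tilde h_k$ is not almost surely $0$, then almost surely half-half is optimal with constant $c=\mathbb E[|\tilde h_k|^2]\,\mathbb E[|\tilde h_k|^4]$. (b) (Fully correlated, free-space channel.) If almost surely $|\tilde h_k|=|\tilde h_1|\neq0$ for all $k$, then almost surely half-half is optimal with constant $c=|\tilde h_1|^2|\tilde h_1|^4$; moreover, for every $K\ge2$, for all sufficiently large $P$ every maximizer $K_1$ of $I_K(\cdot,P)$ is $K/2$ (rounded up or down if $K$ is odd), and for even $K$, $I_K(K/2,P)-R^\star_{K,c}(P)\to0$ as $P\to\infty$. In particular, if the common magnitude is a deterministic constant (free space), all this holds with $c=\mathbb E[|\tilde h_k|^2]\,\mathbb E[|\tilde h_k|^4]$. -/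

import Mathlib

open MeasureTheory ProbabilityTheory Filter Topology
open scoped NNReal ENNReal

noncomputable section

namespace SplittingReceiver

/-- The circularly symmetric complex Gaussian law `CN(0, v)`: the real and imaginary parts are
independent, each with law `N(0, v / 2)`. -/
def complexGaussian (v : ℝ≥0) : Measure ℂ :=
  ((gaussianReal 0 (v / 2)).prod (gaussianReal 0 (v / 2))).map
    Complex.measurableEquivRealProd.symm

/-- Mutual information, in bits, of two random variables: the Kullback-Leibler divergence of their
joint law from the product of their marginal laws, divided by `ln 2`. -/
def mutualInfo {Ω α β : Type*} [MeasurableSpace Ω] [MeasurableSpace α] [MeasurableSpace β]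
    (Q : Measure Ω) (U : Ω → α) (V : Ω → β) : ℝ≥0∞ :=
  InformationTheory.klDiv (Q.map fun ω => (U ω, V ω)) ((Q.map U).prod (Q.map V)) /
    ENNReal.ofReal (Real.log 2)

/-- `Θ₁ = ∑ ρₖ |hₖ|²`. -/
def theta1 {K : ℕ} (ρ : Fin K → ℝ) (h : Fin K → ℂ) : ℝ := ∑ k, ρ k * ‖h k‖ ^ 2

/-- `Θ₂ = ∑ (1 - ρₖ)² |hₖ|⁴`. -/
def theta2 {K : ℕ} (ρ : Fin K → ℝ) (h : Fin K → ℂ) : ℝ := ∑ k, (1 - ρ k) ^ 2 * ‖h k‖ ^ 4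

/-- Output `Y₁ = √Θ₁ √P X + Z` of the coherent-detection branch after maximal ratio combining. -/
def coherentOutput {Ω : Type*} (X Z : Ω → ℂ) (P : ℝ) {K : ℕ} (ρ : Fin K → ℝ) (h : Fin K → ℂ) :
    Ω → ℂ :=
  fun ω => (√(theta1 ρ h) : ℂ) * (√P : ℂ) * X ω + Z ω

/-- Output `Y₂ = √Θ₂ P |X|² + N` of the power-detection branch after maximal ratio combining. -/
def powerOutput {Ω : Type*} (X : Ω → ℂ) (N : Ω → ℝ) (P : ℝ) {K : ℕ} (ρ : Fin K → ℝ)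
    (h : Fin K → ℂ) : Ω → ℝ :=
  fun ω => √(theta2 ρ h) * P * ‖X ω‖ ^ 2 + N ω

/-- Mutual information `I(√P X; Y₁, Y₂)` (in bits) of the splitting channel with splitting ratios
`ρ` and channel coefficients `h`. -/
def splittingMI {Ω : Type*} [MeasurableSpace Ω] (Q : Measure Ω) (X Z : Ω → ℂ) (N : Ω → ℝ)
    (P : ℝ) {K : ℕ} (ρ : Fin K → ℝ) (h : Fin K → ℂ) : ℝ≥0∞ :=
  mutualInfo Q (fun ω => (√P : ℂ) * X ω)
    (fun ω => (coherentOutput X Z P ρ h ω, powerOutput X N P ρ h ω))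

/-- Splitting ratios of the simplified receiver: the first `K₁` antennas are connected to
coherent-detection circuits, the remaining ones to power-detection circuits. -/
def simplifiedRatio (K K₁ : ℕ) : Fin K → ℝ := fun k => if (k : ℕ) < K₁ then 1 else 0

/-- Mutual information (in bits) of the simplified receiver that uses the first `K` antennas of an
infinite array with channel coefficients `h`, the first `K₁` of them coherently. -/
def simplifiedMI {Ω : Type*} [MeasurableSpace Ω] (Q : Measure Ω) (X Z : Ω → ℂ) (N : Ω → ℝ)
    (h : ℕ → ℂ) (K K₁ : ℕ) (P : ℝ) : ℝ≥0∞ :=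
  splittingMI Q X Z N P (simplifiedRatio K K₁) (fun k : Fin K => h k)

/-- `K₁` is an optimal number (`1 ≤ K₁ < K`) of coherent antennas for the objective `I`. -/
def IsOptimalSplit (I : ℕ → ℝ≥0∞) (K K₁ : ℕ) : Prop :=
  K₁ ∈ Finset.Ico 1 K ∧ ∀ j ∈ Finset.Ico 1 K, I j ≤ I K₁

/-- `log₂ (√2 P^{3/2} √(K₁ (K - K₁) c) / (σ₁ σ₂)) - γ / (2 ln 2)`. -/
def splitRate (σ₁ σ₂ c : ℝ) (K K₁ : ℕ) (P : ℝ) : ℝ :=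
  Real.logb 2 (√2 * P ^ (3 / 2 : ℝ) * √((K₁ : ℝ) * ((K : ℝ) - K₁) * c) / (σ₁ * σ₂))
    - Real.eulerMascheroniConstant / (2 * Real.log 2)

/-- `log₂ (K P^{3/2} √c / (√2 σ₁ σ₂)) - γ / (2 ln 2)`. -/
def maxRate (σ₁ σ₂ c : ℝ) (K : ℕ) (P : ℝ) : ℝ :=
  Real.logb 2 ((K : ℝ) * P ^ (3 / 2 : ℝ) * √c / (√2 * σ₁ * σ₂))
    - Real.eulerMascheroniConstant / (2 * Real.log 2)

/-- The half-half split is optimal for a large number `K` of antennas in the high SNR regime, with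
maximal rate `maxRate σ₁ σ₂ c`. Here `I K K₁ P` is the mutual information with `K₁` coherent
antennas among `K`. For every `ε > 0`, for all sufficiently large `K`, and then for all sufficiently
large `P`:
* all the mutual informations are finite;
* connecting half of the antennas to each kind of circuit is within `ε` of every other choice;
* it is strictly better than each choice whose proportion `K₁ / K` is not within `ε` of `1 / 2`;
* it achieves `maxRate` up to `ε`;
* every optimal choice has a proportion within `ε` of `1 / 2`, and its value, which is the maximal
  mutual information, is `maxRate` up to `ε`;
* for `ε ≤ K₁ / K ≤ 1 - ε` the mutual information is `splitRate` up to `ε`, so that it depends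
  on `K₁` through `K₁ K₂`. -/
def HalfSplitOptimal (σ₁ σ₂ c : ℝ) (I : ℕ → ℕ → ℝ → ℝ≥0∞) : Prop :=
  ∀ ε : ℝ, 0 < ε → ∀ᶠ K : ℕ in atTop, ∀ᶠ P : ℝ in atTop,
    (∀ K₁ ∈ Finset.Ico 1 K, I K K₁ P ≠ ∞) ∧
    (∀ K₁ ∈ Finset.Ico 1 K, (I K K₁ P).toReal ≤ (I K (K / 2) P).toReal + ε) ∧
    (∀ K₁ ∈ Finset.Ico 1 K, ε < |(K₁ : ℝ) / K - 1 / 2| → I K K₁ P < I K (K / 2) P) ∧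
    |(I K (K / 2) P).toReal - maxRate σ₁ σ₂ c K P| ≤ ε ∧
    (∀ K₁, IsOptimalSplit (fun j => I K j P) K K₁ →
      |(K₁ : ℝ) / K - 1 / 2| ≤ ε ∧ |(I K K₁ P).toReal - maxRate σ₁ σ₂ c K P| ≤ ε) ∧
    (∀ K₁ : ℕ, ε * K ≤ K₁ → (K₁ : ℝ) ≤ (1 - ε) * K →
      |(I K K₁ P).toReal - splitRate σ₁ σ₂ c K K₁ P| ≤ ε)

/-- The sharper form for antennas with equal gains: for every `K ≥ 2`, at high SNR every optimal
`K₁` is `K / 2` (rounded up or down if `K` is odd), and for even `K` the mutual information of the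
half-half split differs from `maxRate` by a quantity that tends to `0` as `P → ∞`. -/
def HalfSplitExact (σ₁ σ₂ c : ℝ) (I : ℕ → ℕ → ℝ → ℝ≥0∞) : Prop :=
  ∀ K : ℕ, 2 ≤ K →
    (∀ᶠ P : ℝ in atTop, ∀ K₁, IsOptimalSplit (fun j => I K j P) K K₁ →
      K₁ = K / 2 ∨ K₁ = (K + 1) / 2) ∧
    (Even K → Tendsto (fun P : ℝ => (I K (K / 2) P).toReal - maxRate σ₁ σ₂ c K P)
      atTop (𝓝 0))

end SplittingReceiver

end

open SplittingReceiver

/-! In nats, the information of the channel with coherent gain A = √(Θ₁P) and power gain B = √Θ₂·P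
is log(√2·A·B/(σ₁σ₂)) − γ/2 + o(1) when Θ₁Θ₂ > 0, and at most log P + C when Θ₁Θ₂ = 0. Relative to
the split-independent part `baseRate`, the information in bits therefore tends to ½ log₂(Θ₁Θ₂), read
as −∞ when the product vanishes. The optimal split is governed by Θ₁Θ₂ alone.

The upper half (`channelInfo_le`) is duality: replacing the true output density by any density q
only increases ∫ log(k/q), where k is the transition density. Here q gives Y₁ its true law, and
gives Y₂ the Gaussian law with its true conditional mean and variance given Y₁. A reflection of the
Gaussian pair (input, coherent noise) into (normalized Y₁, estimation error) makes these conditional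
moments explicit. At high SNR the conditional variance is essentially a multiple of ‖U‖² with U
standard complex Gaussian, and E log ‖U‖² = −γ.

The lower half (`le_channelInfo`) tests the variational formula with an approximate posterior: ‖X‖²
Gaussian around Y₂/B, the phase of X Gaussian around the phase of Y₁. Its only loss is governed by a
normalized squared phase error, whose mean tends to 1 by dominated convergence
(`tendsto_integral_phaseError`); the two bounds then agree.

For the simplified receiver, Θ₁Θ₂ = S(K₁)(U(K) − U(K₁)), with S and U the partial sums of ‖hₖ‖² and
‖hₖ‖⁴. By the strong law this is c·K₁(K − K₁) up to δK², uniformly in K₁ ≤ K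
(`eventually_abs_mul_sub_le`). Since K is fixed before P → ∞, only finitely many limits in P are
compared, and the maximum of K₁(K − K₁) at K/2 decides (`HighSNRExpansion.halfSplitOptimal`). With
equal magnitudes the product is exactly c·K₁(K − K₁), which gives the sharper form for every K ≥ 2.
-/

noncomputable section

namespace SplittingReceiver

/-! ### Upper and lower bounds for Kullback-Leibler divergences of channels. -/

section KullbackLeibler

variable {α : Type*} [MeasurableSpace α]

/-- If `log dμ/dν = f + log w` where `w` has `μ`-mean at most one, the divergence of `μ` from `ν`
is finite and at most `∫ f dμ`. -/
theorem klDiv_le_of_llr_eq_add_log {μ ν : Measure α} [IsProbabilityMeasure μ]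
    [IsProbabilityMeasure ν] (hac : μ ≪ ν) {f w : α → ℝ} (hf : Integrable f μ)
    (hw : Measurable w) (hpos : ∀ᵐ x ∂μ, 0 < w x) (hw1 : ∫⁻ x, ENNReal.ofReal (w x) ∂μ ≤ 1)
    (h : ∀ᵐ x ∂μ, llr μ ν x = f x + Real.log (w x)) :
    InformationTheory.klDiv μ ν ≤ ENNReal.ofReal (∫ x, f x ∂μ) := by
  have hwi : Integrable w μ := by
    refine ⟨hw.aestronglyMeasurable, ?_⟩
    rw [hasFiniteIntegral_iff_ofReal (hpos.mono fun _ => le_of_lt)]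
    exact hw1.trans_lt ENNReal.one_lt_top
  have hwint : ∫ x, w x ∂μ ≤ 1 := by
    rw [integral_eq_lintegral_of_nonneg_ae (hpos.mono fun _ => le_of_lt) hw.aestronglyMeasurable]
    exact ENNReal.toReal_le_of_le_ofReal zero_le_one (by simpa using hw1)
  have hri : Integrable (fun x => (ν.rnDeriv μ x).toReal) μ := Measure.integrable_toReal_rnDeriv
  -- `llr` is squeezed between integrable functions: log w ≤ w − 1 bounds it above, and 1 − llr ≤
  -- exp(−llr) = dν/dμ bounds it below.
  have hl : Integrable (llr μ ν) μ := by
    refine ((hf.norm.add hwi).add hri).mono' (measurable_llr μ ν).aestronglyMeasurable ?_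
    filter_upwards [h, hpos, exp_neg_llr hac] with x hx hp he
    have h1 : Real.log (w x) ≤ w x - 1 := Real.log_le_sub_one_of_pos hp
    have h2 : -llr μ ν x + 1 ≤ (ν.rnDeriv μ x).toReal := he ▸ Real.add_one_le_exp _
    have h3 : 0 ≤ (ν.rnDeriv μ x).toReal := ENNReal.toReal_nonneg
    have h4 := abs_nonneg (f x)
    simp only [Pi.add_apply, Real.norm_eq_abs]
    rw [abs_le]
    constructor
    · linarith
    · linarith [le_abs_self (f x)]
  rw [InformationTheory.klDiv_of_ac_of_integrable hac hl]
  apply ENNReal.ofReal_le_ofReal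
  simp only [probReal_univ, add_sub_cancel_right]
  have hwi1 : Integrable (fun x => w x - 1) μ := hwi.sub (integrable_const 1)
  have : ∫ x, llr μ ν x ∂μ ≤ ∫ x, (f x + (w x - 1)) ∂μ := by
    refine integral_mono_ae hl (hf.add hwi1) ?_
    filter_upwards [h, hpos] with x hx hp
    rw [hx]
    linarith [Real.log_le_sub_one_of_pos hp]
  rw [integral_add hf hwi1, integral_sub hwi (integrable_const 1)] at this
  simp only [integral_const, probReal_univ, smul_eq_mul, mul_one] at this
  linarith

/-- Variational lower bound for the divergence. -/
theorem integral_log_le_klDiv {μ ν : Measure α} [IsProbabilityMeasure μ]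
    [IsProbabilityMeasure ν] (hfin : InformationTheory.klDiv μ ν ≠ ∞) {g : α → ℝ}
    (hg : Measurable g) (hpos : ∀ᵐ x ∂μ, 0 < g x) (hg1 : ∫⁻ x, ENNReal.ofReal (g x) ∂ν ≤ 1)
    (hi : Integrable (fun x => Real.log (g x)) μ) :
    ∫ x, Real.log (g x) ∂μ ≤ (InformationTheory.klDiv μ ν).toReal := by
  obtain ⟨hac, hl⟩ := InformationTheory.klDiv_ne_top_iff.1 hfin
  rw [InformationTheory.toReal_klDiv_of_measure_eq hac (by simp)]
  set r : α → ℝ := fun x => (ν.rnDeriv μ x).toReal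
  -- The part of ν absolutely continuous with respect to μ has mass at most that of ν, so g·dν/dμ
  -- has μ-mean at most 1. The bound then follows from 1 + log(g·r) ≤ g·r, since log r = −llr.
  have hle : ∫⁻ x, ENNReal.ofReal (g x * r x) ∂μ ≤ 1 := by
    calc ∫⁻ x, ENNReal.ofReal (g x * r x) ∂μ
        ≤ ∫⁻ x, ν.rnDeriv μ x * ENNReal.ofReal (g x) ∂μ := by
          refine lintegral_mono fun x => ?_
          rw [mul_comm, ENNReal.ofReal_mul ENNReal.toReal_nonneg]
          gcongr
          exact ENNReal.ofReal_toReal_le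
      _ = ∫⁻ x, ENNReal.ofReal (g x) ∂(μ.withDensity (ν.rnDeriv μ)) :=
          (lintegral_withDensity_eq_lintegral_mul _ (Measure.measurable_rnDeriv ν μ)
            (by fun_prop : Measurable fun x => ENNReal.ofReal (g x))).symm
      _ ≤ ∫⁻ x, ENNReal.ofReal (g x) ∂ν :=
          lintegral_mono' (Measure.withDensity_rnDeriv_le ν μ) le_rfl
      _ ≤ 1 := hg1
  have hm : Measurable fun x => g x * r x :=
    hg.mul (Measure.measurable_rnDeriv ν μ).ennreal_toReal
  have hnn : 0 ≤ᵐ[μ] fun x => g x * r x :=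
    hpos.mono fun x hx => mul_nonneg hx.le ENNReal.toReal_nonneg
  have hgi : Integrable (fun x => g x * r x) μ := by
    refine ⟨hm.aestronglyMeasurable, ?_⟩
    rw [hasFiniteIntegral_iff_ofReal hnn]
    exact hle.trans_lt ENNReal.one_lt_top
  have hgint : ∫ x, g x * r x ∂μ ≤ 1 := by
    rw [integral_eq_lintegral_of_nonneg_ae hnn hm.aestronglyMeasurable]
    exact ENNReal.toReal_le_of_le_ofReal zero_le_one (by simpa using hle)
  have hgi1 : Integrable (fun x => g x * r x - 1) μ := hgi.sub (integrable_const 1)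
  have : ∫ x, Real.log (g x) ∂μ ≤ ∫ x, (llr μ ν x + (g x * r x - 1)) ∂μ := by
    refine integral_mono_ae hi (hl.add hgi1) ?_
    filter_upwards [hpos, exp_neg_llr hac] with x hp he
    have h1 : Real.log (g x) - llr μ ν x + 1 ≤ g x * r x := by
      have := Real.add_one_le_exp (Real.log (g x) + -llr μ ν x)
      rw [Real.exp_add, Real.exp_log hp, he] at this
      linarith
    linarith
  rw [integral_add hl hgi1, integral_sub hgi (integrable_const 1)] at this
  simp only [integral_const, probReal_univ, smul_eq_mul, mul_one] at this
  linarith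

variable {β : Type*} [MeasurableSpace β]

/-- Duality upper bound for the information of a channel with conditional density `k`: any
probability density `q` on the output space bounds it by `∫ log (k / q)`. -/
theorem klDiv_channel_le (ν : Measure α) [IsProbabilityMeasure ν] (l : Measure β) [SigmaFinite l]
    {k : α × β → ℝ} (hk : Measurable k) (hkpos : ∀ z, 0 < k z) {J : Measure (α × β)}
    (hJ : J = (ν.prod l).withDensity fun z => ENNReal.ofReal (k z)) [IsProbabilityMeasure J]
    {q : β → ℝ} (hq : Measurable q) (hqpos : ∀ y, 0 < q y) (hq1 : ∫⁻ y, ENNReal.ofReal (q y) ∂l ≤ 1)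
    (hint : Integrable (fun z => Real.log (k z) - Real.log (q z.2)) J) :
    InformationTheory.klDiv J (ν.prod (J.map Prod.snd))
      ≤ ENNReal.ofReal (∫ z, (Real.log (k z) - Real.log (q z.2)) ∂J) := by
  -- p is the density of the output law; k / p is then the density of J with respect to the product
  -- of its marginals.
  set p : β → ℝ≥0∞ := fun y => ∫⁻ x, ENNReal.ofReal (k (x, y)) ∂ν with hp
  have hpm : Measurable p := by
    exact Measurable.lintegral_prod_left' (f := fun z => ENNReal.ofReal (k z)) (by fun_prop)
  have hmap : J.map Prod.snd = l.withDensity p := by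
    ext s hs
    rw [Measure.map_apply measurable_snd hs, hJ, withDensity_apply _ (measurable_snd hs),
      withDensity_apply _ hs, ← lintegral_indicator (measurable_snd hs),
      lintegral_prod_symm _ (by
        refine Measurable.aemeasurable (Measurable.indicator (by fun_prop) (measurable_snd hs))),
      ← lintegral_indicator hs]
    refine lintegral_congr fun y => ?_
    by_cases hy : y ∈ s
    · simp [hy, hp, Set.indicator]
    · simp [hy, Set.indicator]
  have hPV : IsProbabilityMeasure (J.map Prod.snd) :=
    Measure.isProbabilityMeasure_map measurable_snd.aemeasurable
  have hp0 : ∀ y, p y ≠ 0 := by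
    intro y hy
    rw [hp, lintegral_eq_zero_iff (by fun_prop)] at hy
    obtain ⟨x, hx⟩ := hy.exists
    simp only [Pi.zero_apply, ENNReal.ofReal_eq_zero] at hx
    exact absurd (hkpos (x, y)) (not_lt.2 hx)
  have hpint : ∫⁻ y, p y ∂l = 1 := by
    have : l.withDensity p Set.univ = 1 := by rw [← hmap]; exact measure_univ
    simpa using this
  have hptop : ∀ᵐ y ∂l, p y < ∞ := ae_lt_top hpm (by simp [hpint])
  have hprod : ν.prod (J.map Prod.snd) = (ν.prod l).withDensity fun z => p z.2 := by
    have : SFinite (l.withDensity p) := by rw [← hmap]; infer_instance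
    rw [hmap, MeasureTheory.prod_withDensity_right hpm]
  have hptop' : ∀ᵐ z ∂(ν.prod l), p z.2 < ∞ := by
    exact (Measure.quasiMeasurePreserving_snd (μ := ν) (ν := l)).ae hptop
  set ρ : α × β → ℝ≥0∞ := fun z => ENNReal.ofReal (k z) / p z.2 with hρ
  have hρm : Measurable ρ := by
    refine Measurable.div (by fun_prop) (hpm.comp measurable_snd)
  have hJρ : J = (ν.prod (J.map Prod.snd)).withDensity ρ := by
    rw [hprod, ← withDensity_mul _ (show Measurable fun z : α × β => p z.2 from hpm.comp measurable_snd) hρm, hJ]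
    refine withDensity_congr_ae ?_
    filter_upwards [hptop'] with z hz
    simp only [Pi.mul_apply, hρ]
    rw [ENNReal.mul_div_cancel (hp0 _) hz.ne]
  have hac : J ≪ ν.prod (J.map Prod.snd) := by
    conv_lhs => rw [hJρ]
    exact withDensity_absolutelyContinuous _ _
  have hrn : J.rnDeriv (ν.prod (J.map Prod.snd)) =ᵐ[J] ρ := by
    refine hac.ae_le ?_
    have := Measure.rnDeriv_withDensity (ν.prod (J.map Prod.snd)) hρm
    rwa [← hJρ] at this
  have hJac : J ≪ ν.prod l := by rw [hJ]; exact withDensity_absolutelyContinuous _ _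
  -- log(k/p) = log(k/q) + log(q/p), and q/p has mean ∫ q ≤ 1 under J. Applying Jensen to the second
  -- term discards the divergence of the output law from q.
  refine klDiv_le_of_llr_eq_add_log hac (f := fun z => Real.log (k z) - Real.log (q z.2))
    (w := fun z => q z.2 / (p z.2).toReal) hint
    ((hq.comp measurable_snd).div (hpm.comp measurable_snd).ennreal_toReal) ?_ ?_ ?_
  · filter_upwards [hJac.ae_le hptop'] with z hz
    exact div_pos (hqpos _) (ENNReal.toReal_pos (hp0 _) hz.ne)
  · have hm : Measurable fun y => ENNReal.ofReal (q y / (p y).toReal) :=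
      (hq.div hpm.ennreal_toReal).ennreal_ofReal
    calc ∫⁻ z, ENNReal.ofReal (q z.2 / (p z.2).toReal) ∂J
        = ∫⁻ y, ENNReal.ofReal (q y / (p y).toReal) ∂(J.map Prod.snd) :=
          (lintegral_map hm measurable_snd).symm
      _ = ∫⁻ y, p y * ENNReal.ofReal (q y / (p y).toReal) ∂l := by
          rw [hmap, lintegral_withDensity_eq_lintegral_mul _ hpm hm]; rfl
      _ = ∫⁻ y, ENNReal.ofReal (q y) ∂l := by
          refine lintegral_congr_ae (hptop.mono fun y hy => ?_)
          have : 0 < (p y).toReal := ENNReal.toReal_pos (hp0 _) hy.ne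
          simp only []
          rw [ENNReal.ofReal_div_of_pos this, ENNReal.ofReal_toReal hy.ne,
            ENNReal.mul_div_cancel (hp0 _) hy.ne]
      _ ≤ 1 := hq1
  · filter_upwards [hJac.ae_le hptop', hrn] with z hz hr
    have h0 : 0 < (p z.2).toReal := ENNReal.toReal_pos (hp0 _) hz.ne
    rw [llr_def]
    simp only [hr, hρ, ENNReal.toReal_div, ENNReal.toReal_ofReal (hkpos z).le]
    rw [Real.log_div (hkpos z).ne' h0.ne', Real.log_div (hqpos _).ne' h0.ne']
    ring

/-- The joint law of an input and of a function of it corrupted by independent additive noise with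
a density. -/
theorem map_add_noise_eq_withDensity [AddGroup β] [MeasurableAdd₂ β] [MeasurableSub₂ β]
    (ν : Measure α) [SFinite ν] (l : Measure β) [SigmaFinite l]
    [l.IsAddRightInvariant] {r : β → ℝ≥0∞} (hr : Measurable r) {N : Measure β} [SFinite N]
    (hN : N = l.withDensity r) {F : α → β} (hF : Measurable F) :
    (ν.prod N).map (fun z => (z.1, z.2 + F z.1))
      = (ν.prod l).withDensity fun z => r (z.2 - F z.1) := by
  have hφ : Measurable fun z : α × β => (z.1, z.2 + F z.1) := by fun_prop
  refine Measure.ext_of_lintegral _ fun f hf => ?_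
  rw [lintegral_map hf hφ, lintegral_withDensity_eq_lintegral_mul _ (by fun_prop) hf,
    lintegral_prod _ (by fun_prop), lintegral_prod _ (by fun_prop)]
  refine lintegral_congr fun x => ?_
  rw [hN, lintegral_withDensity_eq_lintegral_mul _ hr (by fun_prop)]
  simpa using lintegral_add_right_eq_self (μ := l) (fun y => r (y - F x) * f (x, y)) (F x)

end KullbackLeibler

/-! ### The circular complex Gaussian law: density and symmetries. -/

section ComplexGaussian

instance isProbabilityMeasure_complexGaussian (v : ℝ≥0) :
    IsProbabilityMeasure (complexGaussian v) :=
  Measure.isProbabilityMeasure_map (Measurable.aemeasurable (by fun_prop))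

theorem integral_complexGaussian {v : ℝ≥0} (f : ℂ → ℝ) :
    ∫ x, f x ∂(complexGaussian v) =
      ∫ p : ℝ × ℝ, f ⟨p.1, p.2⟩ ∂((gaussianReal 0 (v / 2)).prod (gaussianReal 0 (v / 2))) := by
  rw [complexGaussian, integral_map_equiv]
  rfl

theorem complexGaussian_sq_eq_map (σ : ℝ≥0) :
    complexGaussian (σ ^ 2) = (complexGaussian 1).map fun x => (σ : ℂ) * x := by
  have h : gaussianReal 0 (σ ^ 2 / 2) = (gaussianReal 0 (1 / 2)).map fun x => (σ : ℝ) * x := by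
    rw [gaussianReal_map_const_mul]
    congr 1
    · simp
    · ext; simp [div_eq_mul_inv]
  rw [complexGaussian, complexGaussian, h, Measure.map_prod_map _ _ (by fun_prop) (by fun_prop),
    Measure.map_map (by fun_prop) (by fun_prop), Measure.map_map (by fun_prop) (by fun_prop)]
  congr 1
  ext p
  apply Complex.ext <;> simp [Complex.measurableEquivRealProd]

theorem complexGaussian_eq_withDensity {v : ℝ≥0} (hv : v ≠ 0) :
    complexGaussian v = (volume : Measure ℂ).withDensity
      fun x => ENNReal.ofReal ((Real.pi * v)⁻¹ * Real.exp (-(‖x‖ ^ 2 / v))) := by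
  have hv2 : v / 2 ≠ 0 := by positivity
  refine Measure.ext_of_lintegral _ fun f hf => ?_
  rw [complexGaussian, lintegral_map_equiv, gaussianReal_of_var_ne_zero _ hv2,
    prod_withDensity (by fun_prop) (by fun_prop),
    lintegral_withDensity_eq_lintegral_mul _ (by fun_prop) (by fun_prop),
    lintegral_withDensity_eq_lintegral_mul _ (by fun_prop) (by fun_prop),
    ← (Complex.volume_preserving_equiv_real_prod.symm).lintegral_comp_emb
      Complex.measurableEquivRealProd.symm.measurableEmbedding]
  refine lintegral_congr fun p => ?_
  simp only [Pi.mul_apply, gaussianPDF, gaussianPDFReal]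
  rw [← ENNReal.ofReal_mul (by positivity)]
  congr 2
  have hn : ‖Complex.measurableEquivRealProd.symm p‖ ^ 2 = p.1 ^ 2 + p.2 ^ 2 := by
    rw [← Complex.normSq_eq_norm_sq, Complex.normSq_apply]
    simp [Complex.measurableEquivRealProd]
    ring
  have hv' : (0 : ℝ) < v := by positivity
  rw [hn, mul_mul_mul_comm, ← Real.exp_add, ← mul_inv, Real.mul_self_sqrt (by positivity)]
  push_cast
  congr 2
  · field_simp
  · simp only [sub_zero]; field_simp; ring

/-- The exponent depends on L only through a Euclidean square norm, so invariance of the law under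
reflections and under negation becomes an algebraic identity. -/
theorem charFunDual_complexGaussian (L : StrongDual ℝ ℂ) :
    charFunDual (complexGaussian 1) L
      = Complex.exp (-((((L 1) ^ 2 + (L Complex.I) ^ 2) / 4 : ℝ) : ℂ)) := by
  have h : complexGaussian 1 = ((gaussianReal 0 (1 / 2)).prod (gaussianReal 0 (1 / 2))).map
      (Complex.equivRealProdCLM.symm : ℝ × ℝ →L[ℝ] ℂ) := rfl
  rw [h, charFunDual_map, charFunDual_prod]
  have key (M : StrongDual ℝ ℝ) : charFunDual (gaussianReal 0 (1 / 2)) M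
      = Complex.exp (-((M 1) ^ 2 / 4 : ℝ)) := by
    rw [charFunDual_eq_charFun_map_one]
    rw [gaussianReal_map_continuousLinearMap, charFun_gaussianReal]
    congr 1
    push_cast
    rw [Real.coe_toNNReal _ (by positivity)]
    simp only [map_zero]
    push_cast
    ring
  rw [key, key, ← Complex.exp_add]
  congr 1
  have e1 : (1 : ℂ) = ⟨1, 0⟩ := rfl
  have e2 : Complex.I = ⟨0, 1⟩ := rfl
  simp [Complex.equivRealProdCLM_symm_apply]
  ring

/-- Invariance of a pair of independent standard complex Gaussian variables under a planar
reflection. -/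
theorem measurePreserving_reflection_complexGaussian {c s : ℝ} (h : c ^ 2 + s ^ 2 = 1) :
    MeasurePreserving (fun z : ℂ × ℂ => ((c : ℂ) * z.1 + s * z.2, (s : ℂ) * z.1 - c * z.2))
      ((complexGaussian 1).prod (complexGaussian 1))
      ((complexGaussian 1).prod (complexGaussian 1)) := by
  refine ⟨by fun_prop, ?_⟩
  let R : ℂ × ℂ →L[ℝ] ℂ × ℂ :=
    (c • ContinuousLinearMap.fst ℝ ℂ ℂ + s • ContinuousLinearMap.snd ℝ ℂ ℂ).prod
      (s • ContinuousLinearMap.fst ℝ ℂ ℂ - c • ContinuousLinearMap.snd ℝ ℂ ℂ)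
  have hR : (fun z : ℂ × ℂ => ((c : ℂ) * z.1 + s * z.2, (s : ℂ) * z.1 - c * z.2)) = R := by
    ext z <;> simp [R]
  rw [hR]
  have : IsFiniteMeasure (((complexGaussian 1).prod (complexGaussian 1)).map R) := by
    infer_instance
  refine Measure.ext_of_charFunDual ?_
  ext L
  rw [charFunDual_map, charFunDual_prod, charFunDual_prod]
  simp only [charFunDual_complexGaussian, ← Complex.exp_add]
  congr 1
  set L1 := L.comp (ContinuousLinearMap.inl ℝ ℂ ℂ)
  set L2 := L.comp (ContinuousLinearMap.inr ℝ ℂ ℂ)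
  have hL (x y : ℂ) : L (x, y) = L1 x + L2 y := by
    simp only [L1, L2, ContinuousLinearMap.comp_apply, ContinuousLinearMap.inl_apply,
      ContinuousLinearMap.inr_apply, ← map_add]
    simp
  have hM (M : StrongDual ℝ ℂ) (r : ℝ) (x : ℂ) : M (r * x) = r * M x := by
    rw [← Complex.real_smul, map_smul, smul_eq_mul]
  have e1 (x : ℂ) : ((L.comp R).comp (ContinuousLinearMap.inl ℝ ℂ ℂ)) x = c * L1 x + s * L2 x := by
    simp only [ContinuousLinearMap.comp_apply, ContinuousLinearMap.inl_apply, R]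
    simp only [ContinuousLinearMap.prod_apply, hL]
    simp [hM]
  have e2 (x : ℂ) : ((L.comp R).comp (ContinuousLinearMap.inr ℝ ℂ ℂ)) x = s * L1 x - c * L2 x := by
    simp only [ContinuousLinearMap.comp_apply, ContinuousLinearMap.inr_apply, R]
    simp only [ContinuousLinearMap.prod_apply, hL]
    simp [hM, sub_eq_add_neg]
  rw [e1, e1, e2, e2]
  norm_cast
  linear_combination (-(L1 1 ^ 2 + L1 Complex.I ^ 2 + L2 1 ^ 2 + L2 Complex.I ^ 2) / 4) * h

theorem isGaussian_complexGaussian : IsGaussian (complexGaussian 1) := by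
  have h : complexGaussian 1 = ((gaussianReal 0 (1 / 2)).prod (gaussianReal 0 (1 / 2))).map
      (Complex.equivRealProdCLM.symm : ℝ × ℝ →L[ℝ] ℂ) := rfl
  rw [h]
  infer_instance

theorem integrable_norm_pow_complexGaussian (n : ℕ) :
    Integrable (fun x => ‖x‖ ^ n) (complexGaussian 1) := by
  have := isGaussian_complexGaussian
  rcases Nat.eq_zero_or_pos n with rfl | hn
  · simp
  · have := (IsGaussian.memLp_id (complexGaussian 1) n (by simp)).integrable_norm_pow hn.ne'
    simpa using this

end ComplexGaussian

/-! ### Gaussian moments and the logarithmic moment. -/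

section GaussianMoments

theorem integral_sq_gaussianReal (v : ℝ≥0) : ∫ x, x ^ 2 ∂(gaussianReal 0 v) = v := by
  have h := variance_id_gaussianReal (μ := 0) (v := v)
  rw [variance_of_integral_eq_zero (by fun_prop) (by simp)] at h
  simpa using h

theorem integrable_sq_gaussianReal (v : ℝ≥0) : Integrable (fun x => x ^ 2) (gaussianReal 0 v) := by
  simpa using (memLp_id_gaussianReal (μ := 0) (v := v) 2).integrable_sq

theorem integrable_id_gaussianReal (v : ℝ≥0) : Integrable (fun x : ℝ => x) (gaussianReal 0 v) :=
  (memLp_id_gaussianReal (μ := 0) (v := v) 1).integrable (by simp)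

/-- By circular symmetry every unit direction carries variance 1/2. This produces both the
conditional variance of the power output and the limiting mean of the phase error. -/
theorem integral_sq_re_mul_complexGaussian (a : ℂ) :
    ∫ x, (a * x).re ^ 2 ∂(complexGaussian 1) = ‖a‖ ^ 2 / 2 := by
  rw [integral_complexGaussian]
  set g := gaussianReal 0 ((1 : ℝ≥0) / 2)
  have i1 : Integrable (fun p : ℝ × ℝ => a.re ^ 2 * p.1 ^ 2) (g.prod g) :=
    ((integrable_sq_gaussianReal _).comp_fst g).const_mul _
  have i2 : Integrable (fun p : ℝ × ℝ => a.im ^ 2 * p.2 ^ 2) (g.prod g) :=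
    ((integrable_sq_gaussianReal _).comp_snd g).const_mul _
  have i3 : Integrable (fun p : ℝ × ℝ => 2 * a.re * a.im * (p.1 * p.2)) (g.prod g) :=
    ((integrable_id_gaussianReal _).mul_prod (integrable_id_gaussianReal _)).const_mul _
  have e : (fun p : ℝ × ℝ => (a * (⟨p.1, p.2⟩ : ℂ)).re ^ 2)
      = fun p => a.re ^ 2 * p.1 ^ 2 + a.im ^ 2 * p.2 ^ 2 - 2 * a.re * a.im * (p.1 * p.2) := by
    ext p
    simp only [Complex.mul_re]
    ring
  have i12 : Integrable (fun p : ℝ × ℝ => a.re ^ 2 * p.1 ^ 2 + a.im ^ 2 * p.2 ^ 2) (g.prod g) :=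
    i1.add i2
  rw [e, integral_sub i12 i3]
  rw [integral_add i1 i2, integral_const_mul, integral_const_mul, integral_const_mul,
    integral_prod_mul (fun x : ℝ => x) (fun x : ℝ => x), integral_fun_fst (fun x : ℝ => x ^ 2),
    integral_fun_snd (fun x : ℝ => x ^ 2),
    integral_sq_gaussianReal, integral_id_gaussianReal, ← Complex.normSq_eq_norm_sq,
    Complex.normSq_apply]
  simp
  ring

theorem integrable_sq_re_mul_complexGaussian (a : ℂ) :
    Integrable (fun x => (a * x).re ^ 2) (complexGaussian 1) := by
  refine ((integrable_norm_pow_complexGaussian 2).const_mul (‖a‖ ^ 2)).mono'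
    (Measurable.aestronglyMeasurable (by fun_prop)) (ae_of_all _ fun x => ?_)
  rw [Real.norm_eq_abs, abs_of_nonneg (sq_nonneg _), ← mul_pow, ← norm_mul]
  exact sq_le_sq' (by linarith [Complex.abs_re_le_norm (a * x), neg_abs_le (a * x).re])
    (Complex.re_le_norm _)

theorem integral_norm_sq_complexGaussian : ∫ x, ‖x‖ ^ 2 ∂(complexGaussian 1) = 1 := by
  have h1 := integral_sq_re_mul_complexGaussian 1
  have h2 := integral_sq_re_mul_complexGaussian Complex.I
  have : ∫ x, ‖x‖ ^ 2 ∂(complexGaussian 1)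
      = ∫ x, ((1 * x).re ^ 2 + (Complex.I * x).re ^ 2) ∂(complexGaussian 1) := by
    refine integral_congr_ae (ae_of_all _ fun x => ?_)
    simp only [← Complex.normSq_eq_norm_sq, Complex.normSq_apply]
    simp
    ring
  rw [this, integral_add (integrable_sq_re_mul_complexGaussian _)
    (integrable_sq_re_mul_complexGaussian _), h1, h2]
  norm_num

theorem measurePreserving_neg_complexGaussian :
    MeasurePreserving (fun x : ℂ => -x) (complexGaussian 1) (complexGaussian 1) := by
  refine ⟨by fun_prop, ?_⟩
  have : (fun x : ℂ => -x) = (-ContinuousLinearMap.id ℝ ℂ : ℂ →L[ℝ] ℂ) := by ext; simp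
  rw [this]
  have : IsFiniteMeasure ((complexGaussian 1).map (-ContinuousLinearMap.id ℝ ℂ : ℂ →L[ℝ] ℂ)) := by
    infer_instance
  refine Measure.ext_of_charFunDual ?_
  ext L
  rw [charFunDual_map]
  simp [charFunDual_complexGaussian]

theorem integral_odd_complexGaussian {f : ℂ → ℝ} (hf : ∀ x, f (-x) = -f x) :
    ∫ x, f x ∂(complexGaussian 1) = 0 := by
  have h := measurePreserving_neg_complexGaussian.integral_comp
    (Homeomorph.neg ℂ).measurableEmbedding f
  simp only [hf, integral_neg] at h
  linarith

theorem ae_ne_zero_complexGaussian : ∀ᵐ x ∂(complexGaussian 1), x ≠ 0 := by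
  have : complexGaussian 1 ≪ volume := by
    rw [complexGaussian_eq_withDensity one_ne_zero]
    exact withDensity_absolutelyContinuous _ _
  refine this.ae_le ?_
  exact compl_mem_ae_iff.2 (measure_singleton 0)

theorem integral_complexGaussian_one (f : ℂ → ℝ) :
    ∫ x, f x ∂(complexGaussian 1) = ∫ x : ℂ, Real.pi⁻¹ * Real.exp (-‖x‖ ^ 2) * f x := by
  rw [complexGaussian_eq_withDensity one_ne_zero,
    integral_withDensity_eq_integral_toReal_smul (by fun_prop) (by simp)]
  refine integral_congr_ae (ae_of_all _ fun x => ?_)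
  simp only []
  rw [ENNReal.toReal_ofReal (by positivity)]
  simp

/-- The integral is Γ′(1), by differentiating the Gamma integral under the integral sign, and Γ′(1)
= −γ. -/
theorem integral_log_mul_exp_neg :
    ∫ t in Set.Ioi (0 : ℝ), Real.log t * Real.exp (-t) = -Real.eulerMascheroniConstant := by
  have h1 := Complex.hasDerivAt_GammaIntegral (s := 1) (by simp)
  have h2 : HasDerivAt Complex.GammaIntegral (-(Real.eulerMascheroniConstant : ℂ)) 1 := by
    refine Complex.hasDerivAt_Gamma_one.congr_of_eventuallyEq ?_
    have : {s : ℂ | 0 < s.re} ∈ 𝓝 (1 : ℂ) :=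
      (isOpen_lt continuous_const Complex.continuous_re).mem_nhds (by simp)
    filter_upwards [this] with s hs using (Complex.Gamma_eq_integral hs).symm
  have h3 := h1.unique h2
  have h4 : ∫ t in Set.Ioi (0 : ℝ), (t : ℂ) ^ ((1 : ℂ) - 1) * (Real.log t * Real.exp (-t))
      = ((∫ t in Set.Ioi (0 : ℝ), Real.log t * Real.exp (-t) : ℝ) : ℂ) := by
    rw [← integral_complex_ofReal]
    refine integral_congr_ae (ae_of_all _ fun t => ?_)
    simp
  rw [h4] at h3
  exact_mod_cast h3

/-- ‖X‖² is exponential of mean 1: polar coordinates and t = r² reduce the expectation to ∫ log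
t·e^(−t). This is the source of Euler's constant in the rate. -/
theorem integral_log_norm_sq_complexGaussian :
    ∫ x, Real.log (‖x‖ ^ 2) ∂(complexGaussian 1) = -Real.eulerMascheroniConstant := by
  rw [integral_complexGaussian_one, ← Complex.integral_comp_polarCoord_symm]
  have e : ∀ p ∈ polarCoord.target, p.1 • (Real.pi⁻¹ *
      Real.exp (-‖Complex.polarCoord.symm p‖ ^ 2) * Real.log (‖Complex.polarCoord.symm p‖ ^ 2))
      = (p.1 * Real.exp (-p.1 ^ 2) * Real.log (p.1 ^ 2)) * Real.pi⁻¹ := by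
    intro p hp
    rw [Complex.norm_polarCoord_symm, sq_abs, smul_eq_mul]
    ring
  rw [setIntegral_congr_fun polarCoord.open_target.measurableSet e, polarCoord_target,
    Measure.volume_eq_prod,
    setIntegral_prod_mul (fun r : ℝ => r * Real.exp (-r ^ 2) * Real.log (r ^ 2))
      (fun _ => Real.pi⁻¹)]
  have h := integral_comp_rpow_Ioi_of_pos (g := fun t => Real.log t * Real.exp (-t)) (p := 2)
    two_pos
  rw [integral_log_mul_exp_neg] at h
  rw [← h]
  rw [integral_const, ← integral_mul_const]
  refine setIntegral_congr_fun measurableSet_Ioi fun r hr => ?_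
  have h2 : (2 : ℝ) - 1 = 1 := by norm_num
  have h3 : max (Real.pi + Real.pi) 0 * Real.pi⁻¹ = 2 := by
    rw [max_eq_left (by positivity)]
    field_simp
    norm_num
  simp [h2, h3]
  ring

theorem integrable_log_norm_sq_complexGaussian :
    Integrable (fun x => Real.log (‖x‖ ^ 2)) (complexGaussian 1) := by
  -- A non-integrable function has Bochner integral 0 by convention, whereas this integral equals
  -- −γ, which is nonzero because γ > 1/2.
  by_contra h
  have h1 := integral_log_norm_sq_complexGaussian
  rw [integral_undef h] at h1
  linarith [Real.one_half_lt_eulerMascheroniConstant]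

end GaussianMoments

/-! ### Reduction to a normalized channel with two gains. -/

section Channel

/-- Noiseless output of the combined channel. -/
def signal (A B : ℝ) (x : ℂ) : ℂ × ℝ := ((A : ℂ) * x, B * ‖x‖ ^ 2)

@[fun_prop]
theorem measurable_signal (A B : ℝ) : Measurable (signal A B) := by
  unfold signal
  fun_prop

/-- Law of the noise of the two branches. -/
def noiseLaw (σ₁ σ₂ : ℝ≥0) : Measure (ℂ × ℝ) :=
  (complexGaussian (σ₁ ^ 2)).prod (gaussianReal 0 (σ₂ ^ 2))

instance isProbabilityMeasure_noiseLaw (σ₁ σ₂ : ℝ≥0) : IsProbabilityMeasure (noiseLaw σ₁ σ₂) := by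
  unfold noiseLaw
  infer_instance

/-- Joint law of the input and of the outputs, with branch gains `A` and `B`. -/
def jointLaw (σ₁ σ₂ : ℝ≥0) (A B : ℝ) : Measure (ℂ × (ℂ × ℝ)) :=
  ((complexGaussian 1).prod (noiseLaw σ₁ σ₂)).map fun z => (z.1, z.2 + signal A B z.1)

instance isProbabilityMeasure_jointLaw (σ₁ σ₂ : ℝ≥0) (A B : ℝ) :
    IsProbabilityMeasure (jointLaw σ₁ σ₂ A B) :=
  Measure.isProbabilityMeasure_map (Measurable.aemeasurable (by fun_prop))

/-- Information, in nats, between the input and the outputs. -/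
def channelInfo (σ₁ σ₂ : ℝ≥0) (A B : ℝ) : ℝ≥0∞ :=
  InformationTheory.klDiv (jointLaw σ₁ σ₂ A B)
    ((complexGaussian 1).prod ((jointLaw σ₁ σ₂ A B).map Prod.snd))

/-- Data processing applied to the map and to its inverse. -/
theorem klDiv_map_measurableEquiv {α β : Type*} [MeasurableSpace α] [MeasurableSpace β]
    (e : α ≃ᵐ β) (μ ν : Measure α) [IsFiniteMeasure μ] [IsFiniteMeasure ν] :
    InformationTheory.klDiv (μ.map e) (ν.map e) = InformationTheory.klDiv μ ν := by
  refine le_antisymm (InformationTheory.klDiv_map_le μ ν e.measurable) ?_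
  have h := InformationTheory.klDiv_map_le (μ.map e) (ν.map e) e.symm.measurable
  simpa [Measure.map_map e.symm.measurable e.measurable] using h

/-- Scaling the input by √P ≠ 0 is invertible and leaves the divergence unchanged; the channel
coefficients enter only through the two gains. -/
theorem splittingMI_eq_channelInfo {Ω : Type*} [MeasurableSpace Ω] (Q : Measure Ω)
    [IsProbabilityMeasure Q] {X Z : Ω → ℂ} {N : Ω → ℝ} {σ₁ σ₂ : ℝ≥0}
    (hX : HasLaw X (complexGaussian 1) Q) (hZ : HasLaw Z (complexGaussian (σ₁ ^ 2)) Q)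
    (hN : HasLaw N (gaussianReal 0 (σ₂ ^ 2)) Q) (hZN : IndepFun Z N Q)
    (hXZN : IndepFun X (fun ω => (Z ω, N ω)) Q) {P : ℝ} (hP : 0 < P) {K : ℕ} (ρ : Fin K → ℝ)
    (h : Fin K → ℂ) :
    splittingMI Q X Z N P ρ h
      = channelInfo σ₁ σ₂ (√(theta1 ρ h) * √P) (√(theta2 ρ h) * P)
        / ENNReal.ofReal (Real.log 2) := by
  set A := √(theta1 ρ h) * √P with hA
  set B := √(theta2 ρ h) * P with hB
  have hXm := hX.aemeasurable
  have hZm := hZ.aemeasurable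
  have hNm := hN.aemeasurable
  have hjoint : Q.map (fun ω => (X ω, (Z ω, N ω)))
      = (complexGaussian 1).prod (noiseLaw σ₁ σ₂) := by
    rw [hXZN.map_prod_eq_prod_map_map hXm (hZm.prodMk hNm), hZN.map_prod_eq_prod_map_map hZm hNm,
      hX.map_eq, hZ.map_eq, hN.map_eq, noiseLaw]
  have hmm : AEMeasurable (fun ω => (X ω, (Z ω, N ω))) Q := hXm.prodMk (hZm.prodMk hNm)
  set V : Ω → ℂ × ℝ := fun ω => (coherentOutput X Z P ρ h ω, powerOutput X N P ρ h ω) with hV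
  have hJ : Q.map (fun ω => (X ω, V ω)) = jointLaw σ₁ σ₂ A B := by
    rw [jointLaw, ← hjoint, AEMeasurable.map_map_of_aemeasurable (by fun_prop) hmm]
    congr 1
    ext ω
    · rfl
    · simp only [hV, coherentOutput, powerOutput, signal, Function.comp, hA, hB]
      push_cast
      simp only [Prod.fst_add]
      ring
    · simp only [hV, coherentOutput, powerOutput, signal, Function.comp, hA, hB]
      simp only [Prod.snd_add]
      ring
  -- The pushforward along a map that is not a.e. measurable is 0 by convention; since this one is a
  -- probability measure, measurability follows.
  have hVm : AEMeasurable V Q := by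
    have : AEMeasurable (fun ω => (X ω, V ω)) Q := by
      refine AEMeasurable.of_map_ne_zero ?_
      rw [hJ]
      exact IsProbabilityMeasure.ne_zero _
    exact measurable_snd.comp_aemeasurable this
  have hs : (√P : ℂ) ≠ 0 := by
    exact_mod_cast (Real.sqrt_pos.2 hP).ne'
  let e : ℂ ≃ᵐ ℂ := (Homeomorph.mulLeft₀ (√P : ℂ) hs).toMeasurableEquiv
  have he (x : ℂ) : e x = (√P : ℂ) * x := rfl
  let e' : ℂ × (ℂ × ℝ) ≃ᵐ ℂ × (ℂ × ℝ) := e.prodCongr (MeasurableEquiv.refl _)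
  have he' (z : ℂ × (ℂ × ℝ)) : e' z = (e z.1, z.2) := rfl
  have h1 : Q.map (fun ω => ((√P : ℂ) * X ω, V ω)) = (jointLaw σ₁ σ₂ A B).map e' := by
    rw [← hJ, AEMeasurable.map_map_of_aemeasurable e'.measurable.aemeasurable (hXm.prodMk hVm)]
    rfl
  have h2 : Q.map V = (jointLaw σ₁ σ₂ A B).map Prod.snd := by
    rw [← hJ, AEMeasurable.map_map_of_aemeasurable (by fun_prop) (hXm.prodMk hVm)]
    rfl
  have h3 : Q.map (fun ω => (√P : ℂ) * X ω) = (complexGaussian 1).map e := by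
    rw [← hX.map_eq, AEMeasurable.map_map_of_aemeasurable e.measurable.aemeasurable hXm]
    rfl
  have h4 : ((complexGaussian 1).map e).prod ((jointLaw σ₁ σ₂ A B).map Prod.snd)
      = ((complexGaussian 1).prod ((jointLaw σ₁ σ₂ A B).map Prod.snd)).map e' := by
    have := Measure.isProbabilityMeasure_map (μ := jointLaw σ₁ σ₂ A B)
      measurable_snd.aemeasurable
    have h5 := Measure.map_prod_map (complexGaussian 1) ((jointLaw σ₁ σ₂ A B).map Prod.snd)
      e.measurable measurable_id
    rw [Measure.map_id] at h5
    rw [h5]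
    rfl
  have := Measure.isProbabilityMeasure_map (μ := jointLaw σ₁ σ₂ A B)
    measurable_snd.aemeasurable
  rw [splittingMI, mutualInfo, h1, h2, h3, h4, klDiv_map_measurableEquiv, channelInfo]

/-- Density of the circularly symmetric complex Gaussian law. -/
def complexGaussianPDF (v : ℝ≥0) (x : ℂ) : ℝ := (Real.pi * v)⁻¹ * Real.exp (-(‖x‖ ^ 2 / v))

@[fun_prop]
theorem measurable_complexGaussianPDF (v : ℝ≥0) : Measurable (complexGaussianPDF v) := by
  unfold complexGaussianPDF
  fun_prop

theorem complexGaussianPDF_pos {v : ℝ≥0} (hv : 0 < v) (x : ℂ) : 0 < complexGaussianPDF v x := by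
  unfold complexGaussianPDF
  have : (0 : ℝ) < v := hv
  positivity

theorem log_complexGaussianPDF {v : ℝ≥0} (hv : 0 < v) (x : ℂ) :
    Real.log (complexGaussianPDF v x) = -Real.log (Real.pi * v) - ‖x‖ ^ 2 / v := by
  have : (0 : ℝ) < v := hv
  rw [complexGaussianPDF, Real.log_mul (by positivity) (by positivity), Real.log_inv, Real.log_exp]
  ring

theorem log_gaussianPDFReal (m : ℝ) {v : ℝ≥0} (hv : 0 < v) (x : ℝ) :
    Real.log (gaussianPDFReal m v x)
      = -(Real.log (2 * Real.pi * v) / 2) - (x - m) ^ 2 / (2 * v) := by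
  have : (0 : ℝ) < v := hv
  rw [gaussianPDFReal, Real.log_mul (by positivity) (by positivity), Real.log_inv, Real.log_exp,
    Real.log_sqrt (by positivity)]
  ring

theorem lintegral_complexGaussianPDF {v : ℝ≥0} (hv : 0 < v) :
    ∫⁻ x, ENNReal.ofReal (complexGaussianPDF v x) = 1 := by
  have h : complexGaussian v Set.univ = 1 := measure_univ
  rw [complexGaussian_eq_withDensity hv.ne', withDensity_apply _ MeasurableSet.univ,
    Measure.restrict_univ] at h
  exact h

/-- Transition density of the channel. -/
def channelDensity (σ₁ σ₂ : ℝ≥0) (A B : ℝ) (z : ℂ × (ℂ × ℝ)) : ℝ :=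
  complexGaussianPDF (σ₁ ^ 2) (z.2.1 - A * z.1)
    * gaussianPDFReal 0 (σ₂ ^ 2) (z.2.2 - B * ‖z.1‖ ^ 2)

theorem measurable_channelDensity (σ₁ σ₂ : ℝ≥0) (A B : ℝ) :
    Measurable (channelDensity σ₁ σ₂ A B) := by
  unfold channelDensity
  have := measurable_gaussianPDFReal 0 (σ₂ ^ 2)
  fun_prop

theorem jointLaw_eq_withDensity {σ₁ σ₂ : ℝ≥0} (hσ₁ : 0 < σ₁) (hσ₂ : 0 < σ₂) (A B : ℝ) :
    jointLaw σ₁ σ₂ A B = ((complexGaussian 1).prod volume).withDensity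
      fun z => ENNReal.ofReal (channelDensity σ₁ σ₂ A B z) := by
  have hN : noiseLaw σ₁ σ₂ = (volume : Measure (ℂ × ℝ)).withDensity fun y =>
      ENNReal.ofReal (complexGaussianPDF (σ₁ ^ 2) y.1) *
        ENNReal.ofReal (gaussianPDFReal 0 (σ₂ ^ 2) y.2) := by
    have hm := measurable_gaussianPDFReal 0 (σ₂ ^ 2)
    rw [noiseLaw, complexGaussian_eq_withDensity (by positivity),
      gaussianReal_of_var_ne_zero _ (by positivity), prod_withDensity (by fun_prop) (by fun_prop),
      Measure.volume_eq_prod]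
    rfl
  have hm := measurable_gaussianPDFReal 0 (σ₂ ^ 2)
  have : (volume : Measure (ℂ × ℝ)).IsAddLeftInvariant := by
    rw [Measure.volume_eq_prod]
    infer_instance
  rw [jointLaw, map_add_noise_eq_withDensity (complexGaussian 1) volume (by fun_prop) hN
    (measurable_signal A B)]
  congr 1
  ext z
  rw [channelDensity, ENNReal.ofReal_mul (complexGaussianPDF_pos (by positivity) _).le]
  rfl

/-- Law of the normalized sources of randomness: input, coherent noise and power noise. -/
def sourceLaw (σ₂ : ℝ≥0) : Measure (ℂ × (ℂ × ℝ)) :=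
  (complexGaussian 1).prod ((complexGaussian 1).prod (gaussianReal 0 (σ₂ ^ 2)))

instance isProbabilityMeasure_sourceLaw (σ₂ : ℝ≥0) : IsProbabilityMeasure (sourceLaw σ₂) := by
  unfold sourceLaw
  infer_instance

/-- Input and outputs as functions of the normalized sources of randomness. -/
def channelMap (σ₁ : ℝ≥0) (A B : ℝ) (w : ℂ × (ℂ × ℝ)) : ℂ × (ℂ × ℝ) :=
  (w.1, ((A : ℂ) * w.1 + (σ₁ : ℝ) * w.2.1, B * ‖w.1‖ ^ 2 + w.2.2))

@[fun_prop]
theorem measurable_channelMap (σ₁ : ℝ≥0) (A B : ℝ) : Measurable (channelMap σ₁ A B) := by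
  unfold channelMap
  fun_prop

/-- Coherent noise is σ₁ times a standard variable. Expectations can thus be taken over normalized
sources, where the planar reflection of input and noise is measure preserving. -/
theorem jointLaw_eq_map_sourceLaw (σ₁ σ₂ : ℝ≥0) (A B : ℝ) :
    jointLaw σ₁ σ₂ A B = (sourceLaw σ₂).map (channelMap σ₁ A B) := by
  have hN : noiseLaw σ₁ σ₂ = ((complexGaussian 1).prod (gaussianReal 0 (σ₂ ^ 2))).map
      (Prod.map (fun x => ((σ₁ : ℝ) : ℂ) * x) id) := by
    rw [← Measure.map_prod_map _ _ (by fun_prop) measurable_id, Measure.map_id, noiseLaw,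
      complexGaussian_sq_eq_map]
  have h := Measure.map_prod_map (complexGaussian 1)
    ((complexGaussian 1).prod (gaussianReal 0 (σ₂ ^ 2))) (f := id)
    (g := Prod.map (fun x => ((σ₁ : ℝ) : ℂ) * x) id) measurable_id (by fun_prop)
  rw [Measure.map_id] at h
  rw [jointLaw, hN, h, Measure.map_map (by fun_prop) (by fun_prop), sourceLaw]
  congr 1
  ext w <;> simp [channelMap, signal, add_comm]

/-- Rotation of the pair (input, coherent noise) into (coherent output, estimation error). -/
theorem measurePreserving_sourceLaw (σ₂ : ℝ≥0) {c s : ℝ} (h : c ^ 2 + s ^ 2 = 1) :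
    MeasurePreserving (fun w : ℂ × (ℂ × ℝ) =>
      ((c : ℂ) * w.1 + s * w.2.1, ((s : ℂ) * w.1 - c * w.2.1, w.2.2)))
      (sourceLaw σ₂) (sourceLaw σ₂) := by
  have h1 := measurePreserving_prodAssoc (complexGaussian 1) (complexGaussian 1)
    (gaussianReal 0 (σ₂ ^ 2))
  have h2 := (measurePreserving_reflection_complexGaussian h).prod
    (MeasurePreserving.id (gaussianReal 0 (σ₂ ^ 2)))
  exact (h1.comp h2).comp (h1.symm _)

end Channel

/-! ### Duality upper bound. -/

section UpperBound

/-- Variance of the squared modulus of a standard complex Gaussian variable. -/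
def varNormSq : ℝ := ∫ x, (‖x‖ ^ 2 - 1) ^ 2 ∂(complexGaussian 1)

theorem varNormSq_nonneg : 0 ≤ varNormSq := integral_nonneg fun _ => sq_nonneg _

theorem integrable_normSq_sub_one_sq :
    Integrable (fun x => (‖x‖ ^ 2 - 1) ^ 2) (complexGaussian 1) := by
  have h : (fun x : ℂ => (‖x‖ ^ 2 - 1) ^ 2) = fun x => ‖x‖ ^ 4 - 2 * ‖x‖ ^ 2 + 1 := by
    ext x; ring
  rw [h]
  exact ((integrable_norm_pow_complexGaussian 4).sub
    ((integrable_norm_pow_complexGaussian 2).const_mul 2)).add (integrable_const 1)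

theorem integrable_re_mul_mul_normSq_sub_one (c : ℂ) :
    Integrable (fun x => (c * x).re * (‖x‖ ^ 2 - 1)) (complexGaussian 1) := by
  refine ((integrable_sq_re_mul_complexGaussian c).add integrable_normSq_sub_one_sq).mono'
    (Measurable.aestronglyMeasurable (by fun_prop)) (ae_of_all _ fun x => ?_)
  rw [Real.norm_eq_abs, Pi.add_apply, abs_le]
  constructor <;> nlinarith [sq_nonneg ((c * x).re - (‖x‖ ^ 2 - 1)),
    sq_nonneg ((c * x).re + (‖x‖ ^ 2 - 1))]

/-- The three summands are uncorrelated: the product of the first two is odd under x ↦ −x, and the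
last is centred and independent of both. The sum has the form of the fluctuation of the power output
around its conditional mean given the coherent output. -/
theorem integral_residual_sq (c : ℂ) (d : ℝ) (v : ℝ≥0) :
    Integrable (fun p : ℂ × ℝ => ((c * p.1).re + d * (‖p.1‖ ^ 2 - 1) + p.2) ^ 2)
        ((complexGaussian 1).prod (gaussianReal 0 v)) ∧
    ∫ p : ℂ × ℝ, ((c * p.1).re + d * (‖p.1‖ ^ 2 - 1) + p.2) ^ 2
        ∂((complexGaussian 1).prod (gaussianReal 0 v)) = ‖c‖ ^ 2 / 2 + d ^ 2 * varNormSq + v := by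
  set G := complexGaussian 1
  set g := gaussianReal 0 v
  set a : ℂ → ℝ := fun x => (c * x).re + d * (‖x‖ ^ 2 - 1) with ha
  have ea : (fun x => a x ^ 2) = fun x => (c * x).re ^ 2 + (2 * d) * ((c * x).re * (‖x‖ ^ 2 - 1))
      + d ^ 2 * (‖x‖ ^ 2 - 1) ^ 2 := by
    ext x; simp only [ha]; ring
  have i1 := integrable_sq_re_mul_complexGaussian c
  have i2 := (integrable_re_mul_mul_normSq_sub_one c).const_mul (2 * d)
  have i3 := integrable_normSq_sub_one_sq.const_mul (d ^ 2)
  have i12 : Integrable (fun x => (c * x).re ^ 2 + (2 * d) * ((c * x).re * (‖x‖ ^ 2 - 1))) G :=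
    i1.add i2
  have hai : Integrable (fun x => a x ^ 2) G := by
    rw [ea]; exact i12.add i3
  have haint : ∫ x, a x ^ 2 ∂G = ‖c‖ ^ 2 / 2 + d ^ 2 * varNormSq := by
    rw [ea, integral_add i12 i3, integral_add i1 i2, integral_const_mul, integral_const_mul,
      integral_sq_re_mul_complexGaussian, integral_odd_complexGaussian (by intro x; rw [mul_neg, Complex.neg_re, norm_neg, neg_mul]),
      varNormSq]
    ring
  have ham : Measurable a := by fun_prop
  have ha1 : Integrable a G := by
    refine (hai.add (integrable_const 1)).mono' ham.aestronglyMeasurable (ae_of_all _ fun x => ?_)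
    rw [Real.norm_eq_abs, Pi.add_apply, abs_le]
    constructor <;> nlinarith [sq_nonneg (a x - 1), sq_nonneg (a x + 1)]
  have e : (fun p : ℂ × ℝ => ((c * p.1).re + d * (‖p.1‖ ^ 2 - 1) + p.2) ^ 2)
      = fun p => a p.1 ^ 2 + 2 * (a p.1 * p.2) + p.2 ^ 2 := by
    ext p; simp only [ha]; ring
  have j1 : Integrable (fun p : ℂ × ℝ => a p.1 ^ 2) (G.prod g) := hai.comp_fst g
  have j2 : Integrable (fun p : ℂ × ℝ => 2 * (a p.1 * p.2)) (G.prod g) :=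
    (ha1.mul_prod (integrable_id_gaussianReal v)).const_mul 2
  have j3 : Integrable (fun p : ℂ × ℝ => p.2 ^ 2) (G.prod g) :=
    (integrable_sq_gaussianReal v).comp_snd G
  have j12 : Integrable (fun p : ℂ × ℝ => a p.1 ^ 2 + 2 * (a p.1 * p.2)) (G.prod g) := j1.add j2
  rw [e]
  refine ⟨j12.add j3, ?_⟩
  rw [integral_add j12 j3, integral_add j1 j2, integral_const_mul,
    integral_prod_mul a (fun x : ℝ => x), integral_fun_fst (fun x => a x ^ 2),
    integral_fun_snd (fun x : ℝ => x ^ 2), integral_sq_gaussianReal, integral_id_gaussianReal,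
    haint]
  simp

theorem integrable_log_add_mul_norm_sq {a b : ℝ} (ha : 0 < a) (hb : 0 ≤ b) :
    Integrable (fun x => Real.log (a + b * ‖x‖ ^ 2)) (complexGaussian 1) := by
  refine ((integrable_const (|Real.log a| + a)).add
    ((integrable_norm_pow_complexGaussian 2).const_mul b)).mono'
    (Measurable.aestronglyMeasurable (by fun_prop)) (ae_of_all _ fun x => ?_)
  have h0 : 0 ≤ b * ‖x‖ ^ 2 := by positivity
  have h1 : Real.log a ≤ Real.log (a + b * ‖x‖ ^ 2) := Real.log_le_log ha (by linarith)
  have h2 : Real.log (a + b * ‖x‖ ^ 2) ≤ a + b * ‖x‖ ^ 2 := by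
    linarith [Real.log_le_sub_one_of_pos (show 0 < a + b * ‖x‖ ^ 2 by linarith)]
  simp only [Pi.add_apply]
  rw [Real.norm_eq_abs, abs_le]
  constructor
  · linarith [neg_abs_le (Real.log a)]
  · linarith [abs_nonneg (Real.log a)]

/-- Conditional variance of the power output given the normalized coherent output. -/
def condVar (σ₁ σ₂ : ℝ≥0) (A B : ℝ) (x : ℂ) : ℝ :=
  (σ₂ ^ 2 + (B * (σ₁ ^ 2 / (A ^ 2 + σ₁ ^ 2))) ^ 2 * varNormSq)
    + 2 * B ^ 2 * A ^ 2 * σ₁ ^ 2 / (A ^ 2 + σ₁ ^ 2) ^ 2 * ‖x‖ ^ 2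

theorem integral_comp_measurePreserving {α β : Type*} [MeasurableSpace α] [MeasurableSpace β]
    {μ : Measure α} {ν : Measure β} {φ : α → β} (h : MeasurePreserving φ μ ν) {f : β → ℝ}
    (hf : AEStronglyMeasurable f ν) : ∫ x, f (φ x) ∂μ = ∫ y, f y ∂ν := by
  rw [← h.map_eq] at hf ⊢
  rw [integral_map h.measurable.aemeasurable hf]

-- Under the test density the quadratic terms of the log-likelihood ratio cancel in mean: the
-- normalized coherent output and the normalized coherent noise both have mean square 1, and so do
-- the residual and the power noise, each normalized by its variance. Only the logarithms of the
-- normalizing constants remain.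
set_option maxHeartbeats 1000000 in
theorem channelInfo_le {σ₁ σ₂ : ℝ≥0} (hσ₁ : 0 < σ₁) (hσ₂ : 0 < σ₂) (A B : ℝ) :
    channelInfo σ₁ σ₂ A B ≤ ENNReal.ofReal (Real.log ((A ^ 2 + σ₁ ^ 2) / σ₁ ^ 2)
      + (∫ x, Real.log (condVar σ₁ σ₂ A B x / σ₂ ^ 2) ∂(complexGaussian 1)) / 2) := by
  have h1 : (0 : ℝ) < σ₁ := hσ₁
  have h2 : (0 : ℝ) < σ₂ := hσ₂
  have hS2 : 0 < A ^ 2 + (σ₁ : ℝ) ^ 2 := by positivity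
  -- S² is the variance of the coherent output Y₁. With U = Y₁/S, the input is αU + τE for a
  -- standard complex Gaussian error E independent of U.
  obtain ⟨S, hS, hSS⟩ : ∃ S : ℝ, 0 < S ∧ S ^ 2 = A ^ 2 + σ₁ ^ 2 :=
    ⟨√(A ^ 2 + σ₁ ^ 2), Real.sqrt_pos.2 hS2, Real.sq_sqrt hS2.le⟩
  set α := A / S with hα
  set τ := (σ₁ : ℝ) / S with hτ
  have hατ : α ^ 2 + τ ^ 2 = 1 := by
    rw [hα, hτ]; field_simp; linarith
  have hAα : A = α * S := by rw [hα]; field_simp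
  have hσα : (σ₁ : ℝ) = τ * S := by rw [hτ]; field_simp
  set s2 : ℂ → ℝ := condVar σ₁ σ₂ A B with hs2
  have hs2' (x : ℂ) : s2 x = ‖(2 * B * α * τ : ℝ) * (starRingEnd ℂ) x‖ ^ 2 / 2
      + (B * τ ^ 2) ^ 2 * varNormSq + σ₂ ^ 2 := by
    rw [hs2, condVar, norm_mul, RCLike.norm_conj, mul_pow ‖_‖ ‖x‖, Complex.norm_real,
      Real.norm_eq_abs, sq_abs, ← hSS, hα, hτ]
    field_simp
    ring
  have hs2ge (x : ℂ) : (σ₂ : ℝ) ^ 2 ≤ s2 x := by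
    rw [hs2']
    have := varNormSq_nonneg
    have : 0 ≤ (B * τ ^ 2) ^ 2 * varNormSq := by positivity
    have : 0 ≤ ‖(2 * B * α * τ : ℝ) * (starRingEnd ℂ) x‖ ^ 2 / 2 := by positivity
    linarith
  have hs2pos (x : ℂ) : 0 < s2 x := lt_of_lt_of_le (by positivity) (hs2ge x)
  have hs2m : Measurable s2 := by
    rw [hs2]; unfold condVar; fun_prop
  have hs2c (x : ℂ) : (((s2 x).toNNReal : ℝ≥0) : ℝ) = s2 x := Real.coe_toNNReal _ (hs2pos x).le
  -- Conditional mean of B‖αU + τE‖² given U = x.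
  set m : ℂ → ℝ := fun x => B * (α ^ 2 * ‖x‖ ^ 2 + τ ^ 2) with hm
  have hmm : Measurable m := by fun_prop
  obtain ⟨V, hV⟩ : ∃ V : ℝ≥0, (V : ℝ) = S ^ 2 := ⟨⟨S ^ 2, by positivity⟩, rfl⟩
  have hVpos : 0 < V := by
    have : (0 : ℝ) < V := by rw [hV]; positivity
    exact_mod_cast this
  set u : ℂ → ℂ := fun y => y / S with hu
  have hum : Measurable u := by fun_prop
  -- The first factor is the exact density of Y₁; the second matches only the first two conditional
  -- moments of Y₂, which is all the computation needs.
  set q : ℂ × ℝ → ℝ := fun y => complexGaussianPDF V y.1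
    * gaussianPDFReal (m (u y.1)) (s2 (u y.1)).toNNReal y.2 with hq
  have hs2n (x : ℂ) : 0 < (s2 x).toNNReal := Real.toNNReal_pos.2 (hs2pos x)
  have hqm : Measurable q := by
    have h3 : Measurable fun y : ℂ × ℝ =>
        gaussianPDFReal (m (u y.1)) (s2 (u y.1)).toNNReal y.2 :=
      measurable_uncurry_gaussianPDFReal.comp (f := fun y : ℂ × ℝ =>
        (m (u y.1), (s2 (u y.1)).toNNReal, y.2)) (by fun_prop)
    exact Measurable.mul (by fun_prop) h3
  have hqpos (y : ℂ × ℝ) : 0 < q y :=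
    mul_pos (complexGaussianPDF_pos hVpos _) (gaussianPDFReal_pos _ _ _ (hs2n _).ne')
  have hq1 : ∫⁻ y, ENNReal.ofReal (q y) ≤ 1 := by
    rw [Measure.volume_eq_prod, lintegral_prod _ (by fun_prop)]
    refine le_of_eq ?_
    rw [← lintegral_complexGaussianPDF hVpos]
    refine lintegral_congr fun x => ?_
    simp only [hq, ENNReal.ofReal_mul (complexGaussianPDF_pos hVpos x).le]
    rw [lintegral_const_mul _ (by have := measurable_gaussianPDFReal; fun_prop),
      lintegral_gaussianPDFReal_eq_one _ (hs2n _).ne', mul_one]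
  set φ : ℂ × (ℂ × ℝ) → ℂ × (ℂ × ℝ) := fun w =>
    ((α : ℂ) * w.1 + τ * w.2.1, ((τ : ℂ) * w.1 - α * w.2.1, w.2.2)) with hφ
  have hφp := measurePreserving_sourceLaw σ₂ hατ
  -- the log-likelihood ratio in terms of the rotated source
  set r : ℂ × (ℂ × ℝ) → ℝ := fun w => ((2 * B * α * τ : ℝ) * (starRingEnd ℂ) w.1 * w.2.1).re
    + (B * τ ^ 2) * (‖w.2.1‖ ^ 2 - 1) + w.2.2 with hr
  set f : ℂ × (ℂ × ℝ) → ℝ := fun w => Real.log ((A ^ 2 + σ₁ ^ 2) / σ₁ ^ 2)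
    + Real.log (s2 w.1 / σ₂ ^ 2) / 2 + (‖w.1‖ ^ 2 - ‖(τ : ℂ) * w.1 - α * w.2.1‖ ^ 2)
    + (r w ^ 2 / s2 w.1 - w.2.2 ^ 2 / σ₂ ^ 2) / 2 with hf
  set L : ℂ × (ℂ × ℝ) → ℝ := fun z =>
    Real.log (channelDensity σ₁ σ₂ A B z) - Real.log (q z.2) with hL
  have hLm : Measurable L :=
    (measurable_channelDensity σ₁ σ₂ A B).log.sub (hqm.comp measurable_snd).log
  have hcast : (τ : ℂ) ^ 2 + (α : ℂ) ^ 2 = 1 := by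
    exact_mod_cast (by linarith : τ ^ 2 + α ^ 2 = 1)
  have key (w : ℂ × (ℂ × ℝ)) : L (channelMap σ₁ A B w) = f (φ w) := by
    have hu1 : u ((A : ℂ) * w.1 + (σ₁ : ℝ) * w.2.1) = (φ w).1 := by
      have : (S : ℂ) ≠ 0 := by exact_mod_cast hS.ne'
      simp only [hu, hφ]
      rw [hAα, hσα]
      push_cast
      field_simp
    have hx : w.1 = α * (φ w).1 + τ * (φ w).2.1 := by
      simp only [hφ]
      linear_combination (-w.1) * hcast
    have hz : w.2.1 = τ * (φ w).1 - α * (φ w).2.1 := by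
      simp only [hφ]
      linear_combination (-w.2.1) * hcast
    have hnx : ‖w.1‖ ^ 2 = α ^ 2 * ‖(φ w).1‖ ^ 2 + τ ^ 2 * ‖(φ w).2.1‖ ^ 2
        + 2 * α * τ * ((starRingEnd ℂ) (φ w).1 * (φ w).2.1).re := by
      conv_lhs => rw [hx]
      simp only [← Complex.normSq_eq_norm_sq, Complex.normSq_apply]
      simp
      ring
    have hres : B * ‖w.1‖ ^ 2 + w.2.2 - m (φ w).1 = r (φ w) := by
      have : (φ w).2.2 = w.2.2 := rfl
      simp only [hr, hm, this]
      rw [hnx, mul_assoc ((2 * B * α * τ : ℝ) : ℂ), Complex.re_ofReal_mul]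
      ring
    have hy : ‖(A : ℂ) * w.1 + (σ₁ : ℝ) * w.2.1‖ ^ 2 = S ^ 2 * ‖(φ w).1‖ ^ 2 := by
      rw [← hu1]
      simp only [hu, norm_div, Complex.norm_real, Real.norm_eq_abs, div_pow, sq_abs]
      field_simp
    have hσ₁2 : (0 : ℝ≥0) < σ₁ ^ 2 := by positivity
    have hσ₂2 : (0 : ℝ≥0) < σ₂ ^ 2 := by positivity
    have hz2 : ‖((σ₁ : ℝ) : ℂ) * w.2.1‖ ^ 2 = (σ₁ : ℝ) ^ 2 * ‖w.2.1‖ ^ 2 := by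
      rw [norm_mul, mul_pow, Complex.norm_real, Real.norm_eq_abs, sq_abs]
    simp only [hL, channelDensity, channelMap, hq, hf]
    rw [Real.log_mul (complexGaussianPDF_pos hσ₁2 _).ne'
      (gaussianPDFReal_pos _ _ _ hσ₂2.ne').ne',
      Real.log_mul (complexGaussianPDF_pos hVpos _).ne'
      (gaussianPDFReal_pos _ _ _ (hs2n _).ne').ne', log_complexGaussianPDF hσ₁2,
      log_complexGaussianPDF hVpos, log_gaussianPDFReal _ hσ₂2, log_gaussianPDFReal _ (hs2n _),
      hu1, hs2c, add_sub_cancel_left, add_sub_cancel_left, hres, hy, hV, ← hz, hz2]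
    push_cast
    have hsp := hs2pos (φ w).1
    rw [hSS, Real.log_div hS2.ne' (by positivity), Real.log_div hsp.ne' (by positivity),
      Real.log_mul Real.pi_pos.ne' (by positivity), Real.log_mul Real.pi_pos.ne' hS2.ne',
      Real.log_mul (by positivity) (by positivity), Real.log_mul (by positivity) hsp.ne']
    have : (φ w).2.2 = w.2.2 := rfl
    rw [this]
    field_simp
    ring
  -- integrability and mean of each term
  have iW : Integrable (fun w : ℂ × (ℂ × ℝ) => ‖w.1‖ ^ 2) (sourceLaw σ₂) :=
    (integrable_norm_pow_complexGaussian 2).comp_fst _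
  have iE : Integrable (fun w : ℂ × (ℂ × ℝ) => ‖w.2.1‖ ^ 2) (sourceLaw σ₂) :=
    ((integrable_norm_pow_complexGaussian 2).comp_fst _).comp_snd _
  have iN : Integrable (fun w : ℂ × (ℂ × ℝ) => w.2.2 ^ 2) (sourceLaw σ₂) :=
    ((integrable_sq_gaussianReal _).comp_snd _).comp_snd _
  have nE : ∫ w, ‖w.2.1‖ ^ 2 ∂(sourceLaw σ₂) = 1 := by
    rw [sourceLaw, integral_fun_snd (fun y : ℂ × ℝ => ‖y.1‖ ^ 2),
      integral_fun_fst (fun y : ℂ => ‖y‖ ^ 2), integral_norm_sq_complexGaussian]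
    simp
  have nW : ∫ w, ‖w.1‖ ^ 2 ∂(sourceLaw σ₂) = 1 := by
    rw [sourceLaw, integral_fun_fst (fun y : ℂ => ‖y‖ ^ 2), integral_norm_sq_complexGaussian]
    simp
  have nN : ∫ w, w.2.2 ^ 2 ∂(sourceLaw σ₂) = σ₂ ^ 2 := by
    rw [sourceLaw, integral_fun_snd (fun y : ℂ × ℝ => y.2 ^ 2),
      integral_fun_snd (fun y : ℝ => y ^ 2), integral_sq_gaussianReal]
    simp
  have iZ : Integrable (fun w : ℂ × (ℂ × ℝ) => ‖(τ : ℂ) * w.1 - α * w.2.1‖ ^ 2)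
      (sourceLaw σ₂) := hφp.integrable_comp_of_integrable iE
  have nZ : ∫ w, ‖(τ : ℂ) * w.1 - α * w.2.1‖ ^ 2 ∂(sourceLaw σ₂) = 1 := by
    rw [← nE]
    exact integral_comp_measurePreserving hφp iE.aestronglyMeasurable
  have hrm : Measurable r := by rw [hr]; fun_prop
  -- Given the coherent output, `s2` is exactly the second moment of the residual `r`, so the
  -- normalized square has mean 1 for every x.
  have inner (x : ℂ) : Integrable (fun y : ℂ × ℝ => r (x, y) ^ 2 / s2 x)
        ((complexGaussian 1).prod (gaussianReal 0 (σ₂ ^ 2))) ∧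
      ∫ y, r (x, y) ^ 2 / s2 x ∂((complexGaussian 1).prod (gaussianReal 0 (σ₂ ^ 2))) = 1 := by
    obtain ⟨hi, he⟩ := integral_residual_sq ((2 * B * α * τ : ℝ) * (starRingEnd ℂ) x)
      (B * τ ^ 2) (σ₂ ^ 2)
    refine ⟨hi.div_const _, ?_⟩
    rw [integral_div]
    refine (congrArg (· / s2 x) he).trans ?_
    rw [NNReal.coe_pow, ← hs2' x, div_self (hs2pos x).ne']
  have hrdm : Measurable fun w => r w ^ 2 / s2 w.1 :=
    (hrm.pow_const 2).div (hs2m.comp measurable_fst)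
  have iR : Integrable (fun w => r w ^ 2 / s2 w.1) (sourceLaw σ₂) := by
    rw [sourceLaw, integrable_prod_iff hrdm.aestronglyMeasurable]
    refine ⟨ae_of_all _ fun x => (inner x).1, ?_⟩
    refine (integrable_const (1 : ℝ)).congr (ae_of_all _ fun x => ?_)
    have e : ∀ y : ℂ × ℝ, ‖r (x, y) ^ 2 / s2 (x, y).1‖ = r (x, y) ^ 2 / s2 x := fun y => by
      rw [Real.norm_eq_abs, abs_of_nonneg (div_nonneg (sq_nonneg _) (hs2pos x).le)]
    simp only [e]
    exact (inner x).2.symm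
  have nR : ∫ w, r w ^ 2 / s2 w.1 ∂(sourceLaw σ₂) = 1 := by
    rw [sourceLaw, integral_prod _ iR]
    have : ∀ x : ℂ, ∫ y, r (x, y) ^ 2 / s2 (x, y).1
        ∂((complexGaussian 1).prod (gaussianReal 0 (σ₂ ^ 2))) = 1 := fun x => (inner x).2
    simp only [this]
    simp
  have iL0 : Integrable (fun x => Real.log (s2 x / σ₂ ^ 2)) (complexGaussian 1) := by
    have e : (fun x => Real.log (s2 x / σ₂ ^ 2))
        = fun x => Real.log (s2 x) - Real.log (σ₂ ^ 2) := by
      ext x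
      rw [Real.log_div (hs2pos x).ne' (by positivity)]
    rw [e]
    refine Integrable.sub ?_ (integrable_const _)
    rw [hs2]
    unfold condVar
    refine integrable_log_add_mul_norm_sq ?_ (by positivity)
    have := varNormSq_nonneg
    positivity
  have iL : Integrable (fun w : ℂ × (ℂ × ℝ) => Real.log (s2 w.1 / σ₂ ^ 2)) (sourceLaw σ₂) :=
    iL0.comp_fst _
  have nL : ∫ w, Real.log (s2 w.1 / σ₂ ^ 2) ∂(sourceLaw σ₂)
      = ∫ x, Real.log (s2 x / σ₂ ^ 2) ∂(complexGaussian 1) := by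
    rw [sourceLaw, integral_fun_fst (fun x : ℂ => Real.log (s2 x / σ₂ ^ 2))]
    simp
  have k1 : Integrable (fun w : ℂ × (ℂ × ℝ) => Real.log ((A ^ 2 + σ₁ ^ 2) / σ₁ ^ 2)
    + Real.log (s2 w.1 / σ₂ ^ 2) / 2) (sourceLaw σ₂) := (integrable_const _).add (iL.div_const 2)
  have k2 : Integrable (fun w : ℂ × (ℂ × ℝ) =>
      ‖w.1‖ ^ 2 - ‖(τ : ℂ) * w.1 - α * w.2.1‖ ^ 2) (sourceLaw σ₂) := iW.sub iZ
  have k12 : Integrable (fun w : ℂ × (ℂ × ℝ) => Real.log ((A ^ 2 + σ₁ ^ 2) / σ₁ ^ 2)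
      + Real.log (s2 w.1 / σ₂ ^ 2) / 2 + (‖w.1‖ ^ 2 - ‖(τ : ℂ) * w.1 - α * w.2.1‖ ^ 2))
      (sourceLaw σ₂) := k1.add k2
  have k3 : Integrable (fun w : ℂ × (ℂ × ℝ) => (r w ^ 2 / s2 w.1 - w.2.2 ^ 2 / σ₂ ^ 2) / 2)
      (sourceLaw σ₂) := (iR.sub (iN.div_const _)).div_const 2
  have hfi : Integrable f (sourceLaw σ₂) := k12.add k3
  have hfint : ∫ w, f w ∂(sourceLaw σ₂) = Real.log ((A ^ 2 + σ₁ ^ 2) / σ₁ ^ 2)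
      + (∫ x, Real.log (s2 x / σ₂ ^ 2) ∂(complexGaussian 1)) / 2 := by
    rw [hf, integral_add k12 k3, integral_add k1 k2, integral_sub iW iZ,
      integral_add (integrable_const _) (iL.div_const 2), integral_div, integral_div,
      integral_sub iR (iN.div_const _), integral_div, nR, nN, nW, nZ, nL,
      div_self (by positivity)]
    simp
  have hfφ : Integrable (fun w => f (φ w)) (sourceLaw σ₂) := hφp.integrable_comp_of_integrable hfi
  have hfφint : ∫ w, f (φ w) ∂(sourceLaw σ₂) = ∫ w, f w ∂(sourceLaw σ₂) :=
    integral_comp_measurePreserving hφp hfi.aestronglyMeasurable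
  have hLi : Integrable L (jointLaw σ₁ σ₂ A B) := by
    rw [jointLaw_eq_map_sourceLaw, integrable_map_measure hLm.aestronglyMeasurable (by fun_prop)]
    exact hfφ.congr (ae_of_all _ fun w => (key w).symm)
  have hLint : ∫ z, L z ∂(jointLaw σ₁ σ₂ A B) = Real.log ((A ^ 2 + σ₁ ^ 2) / σ₁ ^ 2)
      + (∫ x, Real.log (s2 x / σ₂ ^ 2) ∂(complexGaussian 1)) / 2 := by
    rw [jointLaw_eq_map_sourceLaw, integral_map (by fun_prop) hLm.aestronglyMeasurable,
      ← hfint, ← hfφint]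
    exact integral_congr_ae (ae_of_all _ key)
  have := klDiv_channel_le (complexGaussian 1) volume (measurable_channelDensity σ₁ σ₂ A B)
    (fun z => mul_pos (complexGaussianPDF_pos (by positivity) _)
      (gaussianPDFReal_pos _ _ _ (by positivity)))
    (jointLaw_eq_withDensity hσ₁ hσ₂ A B) hqm hqpos hq1 hLi
  rw [hLint] at this
  exact this

end UpperBound

/-! ### Asymptotics of the phase error of the coherent branch. -/

section PhaseError

/-- Normalized squared phase error of the coherent branch at amplitude signal-to-noise ratio `t`. -/
def phaseError (t : ℝ) (x z : ℂ) : ℝ :=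
  2 * (t ^ 2 * ‖x‖ ^ 2 * (x * (starRingEnd ℂ) (t * x + z)).arg ^ 2)

theorem phaseError_nonneg (t : ℝ) (x z : ℂ) : 0 ≤ phaseError t x z := by
  unfold phaseError
  positivity

@[fun_prop]
theorem measurable_phaseError (t : ℝ) : Measurable fun p : ℂ × ℂ => phaseError t p.1 p.2 := by
  unfold phaseError
  have : Measurable fun p : ℂ × ℂ => (p.1 * (starRingEnd ℂ) (t * p.1 + p.2)).arg :=
    Complex.measurable_arg.comp (Measurable.mul (by fun_prop)
      (Complex.continuous_conj.measurable.comp (by fun_prop)))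
  fun_prop

/-- Law of cosines in the triangle with vertices 0, tx and tx + z: an angle d at the origin forces
the side z to be long, since 1 − cos d ≥ 2d²/π² on [−π, π]. The bound is uniform in t and serves as
the dominating function. -/
theorem phaseError_le {t : ℝ} (ht : 0 < t) (x z : ℂ) :
    phaseError t x z ≤ 2 * Real.pi ^ 2 * ‖z‖ ^ 2 := by
  unfold phaseError
  rcases eq_or_ne (x * (starRingEnd ℂ) (t * x + z)) 0 with h0 | h0
  · rw [h0, Complex.arg_zero]
    have : 0 ≤ 2 * Real.pi ^ 2 * ‖z‖ ^ 2 := by positivity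
    simpa using this
  set y := (t : ℂ) * x + z with hy
  set d := (x * (starRingEnd ℂ) y).arg with hd
  set c := Real.cos d with hc
  set a := t * ‖x‖ with ha
  set b := ‖y‖ with hb
  have ha0 : 0 ≤ a := by positivity
  have hb0 : 0 ≤ b := norm_nonneg _
  have hre : (x * (starRingEnd ℂ) y).re = ‖x‖ * b * c := by
    have h := Complex.cos_arg h0
    rw [norm_mul, RCLike.norm_conj] at h
    have hne : ‖x‖ * ‖y‖ ≠ 0 := by
      rw [← RCLike.norm_conj y, ← norm_mul]
      exact norm_ne_zero_iff.2 h0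
    rw [hc, hd, h, hb, ← mul_div_assoc, mul_div_cancel_left₀ _ hne]
  have hz : ‖z‖ ^ 2 = a ^ 2 + b ^ 2 - 2 * a * b * c := by
    have : z = y - t * x := by rw [hy]; ring
    have h2 : 2 * a * b * c = 2 * t * (x * (starRingEnd ℂ) y).re := by rw [hre, ha]; ring
    rw [h2, this, ha, hb, mul_pow]
    simp only [← Complex.normSq_eq_norm_sq, Complex.normSq_apply]
    simp
    ring
  have hd2 : 2 / Real.pi ^ 2 * d ^ 2 ≤ 1 - c := by
    have h := Real.cos_le_one_sub_mul_cos_sq (x := d) (Complex.abs_arg_le_pi _)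
    linarith
  have hd3 : d ^ 2 ≤ Real.pi ^ 2 / 2 * (1 - c) := by
    have hp : 0 < Real.pi := Real.pi_pos
    calc d ^ 2 = Real.pi ^ 2 / 2 * (2 / Real.pi ^ 2 * d ^ 2) := by field_simp
      _ ≤ _ := by gcongr
  have hc1 : c ≤ 1 := Real.cos_le_one d
  have hc2 : -1 ≤ c := Real.neg_one_le_cos d
  -- If c ≥ 0, minimizing over b gives ‖z‖² ≥ a²(1 − c²) ≥ a²(1 − c); if c ≤ 0, then ‖z‖² ≥ a² and 1
  -- − c ≤ 2.
  have hkey : a ^ 2 * (1 - c) ≤ 2 * ‖z‖ ^ 2 := by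
    rw [hz]
    rcases le_total 0 c with h | h
    · nlinarith [sq_nonneg (b - a * c), mul_nonneg (sq_nonneg a) (mul_nonneg (sub_nonneg.2 hc1) h),
        mul_nonneg (sq_nonneg a) (sub_nonneg.2 hc1)]
    · nlinarith [mul_nonneg (mul_nonneg ha0 hb0) (neg_nonneg.2 h), sq_nonneg b,
        mul_nonneg (sq_nonneg a) (show 0 ≤ 1 + c by linarith)]
  calc 2 * (t ^ 2 * ‖x‖ ^ 2 * d ^ 2) = 2 * (a ^ 2 * d ^ 2) := by rw [ha]; ring
    _ ≤ 2 * (a ^ 2 * (Real.pi ^ 2 / 2 * (1 - c))) := by gcongr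
    _ = Real.pi ^ 2 * (a ^ 2 * (1 - c)) := by ring
    _ ≤ Real.pi ^ 2 * (2 * ‖z‖ ^ 2) := by gcongr
    _ = _ := by ring

/-- Up to the positive factor t, the number whose argument is taken is ‖x‖² + t⁻¹·x·conj z, so its
argument is asymptotic to Im(x·conj z)/(t‖x‖²). -/
theorem tendsto_phaseError {x : ℂ} (hx : x ≠ 0) (z : ℂ) :
    Tendsto (fun t => phaseError t x z) atTop
      (𝓝 (2 * ((Complex.I * (starRingEnd ℂ) x * z).re ^ 2 / ‖x‖ ^ 2))) := by
  set w : ℝ → ℂ := fun t => (‖x‖ ^ 2 : ℝ) + (t⁻¹ : ℝ) * (x * (starRingEnd ℂ) z) with hw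
  have hnx : 0 < ‖x‖ := norm_pos_iff.2 hx
  have hinv : Tendsto (fun t : ℝ => ((t⁻¹ : ℝ) : ℂ)) atTop (𝓝 ((0 : ℝ) : ℂ)) :=
    (Complex.continuous_ofReal.tendsto 0).comp tendsto_inv_atTop_zero
  have hwlim : Tendsto w atTop (𝓝 ((‖x‖ ^ 2 : ℝ) : ℂ)) := by
    have := (tendsto_const_nhds (x := ((‖x‖ ^ 2 : ℝ) : ℂ))).add
      (hinv.mul_const (x * (starRingEnd ℂ) z))
    simpa [hw] using this
  have harg : Tendsto (fun t => (w t).arg) atTop (𝓝 0) := by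
    have h := (Complex.continuousAt_arg (x := ((‖x‖ ^ 2 : ℝ) : ℂ))
      (Complex.ofReal_mem_slitPlane.2 (by positivity))).tendsto.comp hwlim
    rwa [Complex.arg_ofReal_of_nonneg (by positivity)] at h
  have hnorm : Tendsto (fun t => ‖w t‖) atTop (𝓝 (‖x‖ ^ 2)) := by
    have := hwlim.norm
    rwa [Complex.norm_real, Real.norm_eq_abs, abs_of_nonneg (by positivity)] at this
  -- Dividing by `sinc` converts sin(arg w) = Im w/‖w‖ into arg w without dividing by an argument
  -- that may be 0.
  have hsinc : Tendsto (fun t => Real.sinc (w t).arg) atTop (𝓝 1) := by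
    have := (Real.continuous_sinc.tendsto 0).comp harg
    rwa [Real.sinc_zero] at this
  have hlim : Tendsto (fun t => 2 * (‖x‖ ^ 2 *
      ((x * (starRingEnd ℂ) z).im / ‖w t‖ / Real.sinc (w t).arg) ^ 2)) atTop
      (𝓝 (2 * (‖x‖ ^ 2 * ((x * (starRingEnd ℂ) z).im / ‖x‖ ^ 2 / 1) ^ 2))) :=
    ((((tendsto_const_nhds.div hnorm (by positivity)).div hsinc one_ne_zero).pow 2).const_mul
      _).const_mul _
  have hval : 2 * (‖x‖ ^ 2 * ((x * (starRingEnd ℂ) z).im / ‖x‖ ^ 2 / 1) ^ 2)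
      = 2 * ((Complex.I * (starRingEnd ℂ) x * z).re ^ 2 / ‖x‖ ^ 2) := by
    have : (x * (starRingEnd ℂ) z).im = (Complex.I * (starRingEnd ℂ) x * z).re := by
      simp; ring
    rw [this]
    field_simp
  rw [← hval]
  refine hlim.congr' ?_
  filter_upwards [eventually_gt_atTop 0, hsinc.eventually_ne one_ne_zero,
    hnorm.eventually_ne (show ‖x‖ ^ 2 ≠ 0 by positivity)] with t ht hs hn
  have e1 : (x * (starRingEnd ℂ) (t * x + z)) = (t : ℝ) * w t := by
    have : (t : ℂ) ≠ 0 := by exact_mod_cast ht.ne'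
    have h2 : ((‖x‖ ^ 2 : ℝ) : ℂ) = x * (starRingEnd ℂ) x := by
      rw [Complex.mul_conj, Complex.normSq_eq_norm_sq]
    simp only [hw, h2]
    push_cast
    simp only [map_add, map_mul, Complex.conj_ofReal]
    field_simp
  have e2 : (x * (starRingEnd ℂ) (t * x + z)).arg = (w t).arg := by
    rw [e1, Complex.arg_real_mul _ ht]
  have e3 : t * (w t).im = (x * (starRingEnd ℂ) z).im := by
    simp only [hw, Complex.add_im, Complex.ofReal_im, Complex.im_ofReal_mul]
    field_simp
    simp
  have e4 : Real.sinc (w t).arg * (w t).arg = (w t).im / ‖w t‖ := by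
    rw [← Complex.sin_arg]
    rcases eq_or_ne (w t).arg 0 with h | h
    · simp [h]
    · rw [Real.sinc_of_ne_zero h]
      field_simp
  have e5 : (x * (starRingEnd ℂ) z).im / ‖w t‖ / Real.sinc (w t).arg = t * (w t).arg := by
    rw [div_eq_iff hs, ← e3, mul_div_assoc, ← e4]
    ring
  rw [e5, phaseError, e2]
  ring

theorem integrable_phaseError {t : ℝ} (ht : 0 < t) :
    Integrable (fun p : ℂ × ℂ => phaseError t p.1 p.2)
      ((complexGaussian 1).prod (complexGaussian 1)) := by
  refine (((integrable_norm_pow_complexGaussian 2).comp_snd (complexGaussian 1)).const_mul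
    (2 * Real.pi ^ 2)).mono' (measurable_phaseError t).aestronglyMeasurable
    (ae_of_all _ fun p => ?_)
  rw [Real.norm_eq_abs, abs_of_nonneg (phaseError_nonneg _ _ _)]
  exact phaseError_le ht _ _

/-- Given x ≠ 0, the limit is twice the square of Re(u·z) for a unit u, and Re(u·z) has variance
1/2. -/
theorem tendsto_integral_phaseError :
    Tendsto (fun t => ∫ p : ℂ × ℂ, phaseError t p.1 p.2
      ∂((complexGaussian 1).prod (complexGaussian 1))) atTop (𝓝 1) := by
  set M := (complexGaussian 1).prod (complexGaussian 1)
  have hx : ∀ᵐ p ∂M, p.1 ≠ 0 :=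
    Measure.quasiMeasurePreserving_fst.ae ae_ne_zero_complexGaussian
  have hb : Integrable (fun p : ℂ × ℂ => 2 * Real.pi ^ 2 * ‖p.2‖ ^ 2) M :=
    ((integrable_norm_pow_complexGaussian 2).comp_snd (complexGaussian 1)).const_mul _
  set l : ℂ × ℂ → ℝ := fun p => 2 * ((Complex.I * (starRingEnd ℂ) p.1 * p.2).re ^ 2 / ‖p.1‖ ^ 2)
    with hl
  have hlm : Measurable l := by
    have := Complex.continuous_conj.measurable
    fun_prop
  have key := tendsto_integral_filter_of_dominated_convergence (μ := M) (l := atTop)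
    (F := fun t p => phaseError t p.1 p.2) (f := l) (fun p => 2 * Real.pi ^ 2 * ‖p.2‖ ^ 2)
    (Eventually.of_forall fun t => (measurable_phaseError t).aestronglyMeasurable)
    ((eventually_gt_atTop 0).mono fun t ht => ae_of_all _ fun p => by
      rw [Real.norm_eq_abs, abs_of_nonneg (phaseError_nonneg _ _ _)]
      exact phaseError_le ht _ _) hb
    (hx.mono fun p hp => tendsto_phaseError hp p.2)
  have hli : Integrable l M := by
    refine hb.mono' hlm.aestronglyMeasurable ?_
    filter_upwards [hx] with p hp
    refine le_of_tendsto ((tendsto_phaseError hp p.2).norm) ?_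
    filter_upwards [eventually_gt_atTop 0] with t ht
    rw [Real.norm_eq_abs, abs_of_nonneg (phaseError_nonneg _ _ _)]
    exact phaseError_le ht _ _
  have hint : ∫ p, l p ∂M = 1 := by
    rw [integral_prod _ hli]
    have : ∀ᵐ x ∂(complexGaussian 1), ∫ z, l (x, z) ∂(complexGaussian 1) = 1 := by
      filter_upwards [ae_ne_zero_complexGaussian] with x hx
      simp only [hl]
      rw [integral_const_mul, integral_div, integral_sq_re_mul_complexGaussian, norm_mul,
        RCLike.norm_conj, Complex.norm_I, one_mul]
      have : ‖x‖ ≠ 0 := norm_ne_zero_iff.2 hx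
      field_simp
    rw [integral_congr_ae this]
    simp
  rwa [hint] at key

end PhaseError

/-! ### Variational lower bound from an approximate posterior. -/

section LowerBound

/-- Approximate ratio of the posterior to the prior density of the input: given the outputs, the
squared modulus of the input is treated as Gaussian around the power output, and its phase as
Gaussian around the phase of the coherent output. -/
def posteriorRatio (σ₂ : ℝ≥0) (t B : ℝ) (z : ℂ × (ℂ × ℝ)) : ℝ :=
  2 * √Real.pi * B * t * (‖z.1‖ * Real.exp (‖z.1‖ ^ 2)
    * gaussianPDFReal 0 (σ₂ ^ 2) (z.2.2 - B * ‖z.1‖ ^ 2)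
    * Real.exp (-(t ^ 2 * ‖z.1‖ ^ 2 * (z.1 * (starRingEnd ℂ) z.2.1).arg ^ 2)))

theorem measurable_posteriorRatio (σ₂ : ℝ≥0) (t B : ℝ) :
    Measurable (posteriorRatio σ₂ t B) := by
  unfold posteriorRatio
  have h1 := measurable_gaussianPDFReal 0 (σ₂ ^ 2)
  have h2 : Measurable fun z : ℂ × (ℂ × ℝ) => (z.1 * (starRingEnd ℂ) z.2.1).arg :=
    Complex.measurable_arg.comp (Measurable.mul (by fun_prop)
      (Complex.continuous_conj.measurable.comp (by fun_prop)))
  fun_prop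

theorem lintegral_exp_neg_mul_sq_le {b : ℝ} (hb : 0 < b) (s : Set ℝ) :
    ∫⁻ θ in s, ENNReal.ofReal (Real.exp (-(b * θ ^ 2))) ≤ ENNReal.ofReal √(Real.pi / b) := by
  refine (lintegral_mono' Measure.restrict_le_self le_rfl).trans ?_
  rw [← integral_gaussian b, ofReal_integral_eq_lintegral_ofReal
    (integrable_exp_neg_mul_sq hb) (ae_of_all _ fun _ => (Real.exp_pos _).le)]
  simp

/-- Substitution s = y − Br², injective on r > 0; its image is only a half-line, hence an
inequality. -/
theorem lintegral_mul_comp_sq_le {f : ℝ → ℝ≥0∞} (B y : ℝ) (hB : 0 < B)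
    (hf1 : ∫⁻ s, f s ≤ 1) :
    ∫⁻ r in Set.Ioi (0 : ℝ), ENNReal.ofReal (2 * B * r) * f (y - B * r ^ 2) ≤ 1 := by
  have hd : ∀ r ∈ Set.Ioi (0 : ℝ),
      HasDerivWithinAt (fun r => y - B * r ^ 2) (-(2 * B * r)) (Set.Ioi 0) r := by
    intro r _
    have := ((hasDerivAt_pow 2 r).const_mul B).const_sub y
    refine (this.congr_deriv ?_).hasDerivWithinAt
    simp
    ring
  have hinj : Set.InjOn (fun r : ℝ => y - B * r ^ 2) (Set.Ioi 0) := by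
    intro r hr s hs h
    simp only [Set.mem_Ioi] at hr hs
    have h2 : r ^ 2 = s ^ 2 := by
      have : B * r ^ 2 = B * s ^ 2 := by simpa using h
      exact mul_left_cancel₀ hB.ne' this
    exact (sq_eq_sq₀ hr.le hs.le).1 h2
  have key := lintegral_image_eq_lintegral_abs_deriv_mul measurableSet_Ioi hd hinj f
  calc ∫⁻ r in Set.Ioi (0 : ℝ), ENNReal.ofReal (2 * B * r) * f (y - B * r ^ 2)
      = ∫⁻ r in Set.Ioi (0 : ℝ), ENNReal.ofReal |-(2 * B * r)| * f (y - B * r ^ 2) := by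
        refine setLIntegral_congr_fun measurableSet_Ioi fun r hr => ?_
        have : 0 ≤ 2 * B * r := by have : 0 < r := hr; positivity
        simp only [abs_neg, abs_of_nonneg this]
    _ = _ := key.symm
    _ ≤ ∫⁻ s, f s := lintegral_mono' Measure.restrict_le_self le_rfl
    _ ≤ 1 := hf1

theorem lintegral_comp_mul_unit {u : ℂ} (hu : ‖u‖ = 1) (f : ℂ → ℝ≥0∞) :
    ∫⁻ x : ℂ, f (x * u) = ∫⁻ x : ℂ, f x := by
  have hc : u ∈ Submonoid.unitSphere ℂ := mem_sphere_zero_iff_norm.2 hu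
  let a : Circle := ⟨u, hc⟩
  have ha : (a : ℂ) = u := rfl
  rw [← (rotation a).measurePreserving.lintegral_comp_emb
    (rotation a).toHomeomorph.measurableEmbedding f]
  refine lintegral_congr fun x => ?_
  rw [rotation_apply, ha, mul_comm]

/-- In polar coordinates the posterior factors into 2Br·p(y₂ − Br²) for the radius, with p the
power-noise density, and (tr/√π)·exp(−t²r²θ²) for the phase. Dividing by the area factor r and by
the prior π⁻¹exp(−r²) gives the constant 2√π·B·t. Truncating the phase to (−π, π) and the squared
radius to (0, ∞) only loses mass, and a sub-probability suffices. -/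
theorem lintegral_posteriorRatio_le {σ₂ : ℝ≥0} (hσ₂ : 0 < σ₂) {t B : ℝ} (ht : 0 < t) (hB : 0 < B)
    {y : ℂ × ℝ} (hy : y.1 ≠ 0) :
    ∫⁻ x, ENNReal.ofReal (posteriorRatio σ₂ t B (x, y)) ∂(complexGaussian 1) ≤ 1 := by
  have hσ₂2 : (σ₂ : ℝ≥0) ^ 2 ≠ 0 := by positivity
  have hm : Measurable fun x => ENNReal.ofReal (posteriorRatio σ₂ t B (x, y)) :=
    ((measurable_posteriorRatio σ₂ t B).comp (by fun_prop : Measurable fun x : ℂ => (x, y)))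
      |>.ennreal_ofReal
  set p : ℝ → ℝ := gaussianPDFReal 0 (σ₂ ^ 2) with hp
  have hp0 (s : ℝ) : 0 ≤ p s := gaussianPDFReal_nonneg _ _ _
  set D : ℂ → ℝ≥0∞ := fun x => ENNReal.ofReal (2 * B * t / √Real.pi * (‖x‖ * p (y.2 - B * ‖x‖ ^ 2)
    * Real.exp (-(t ^ 2 * ‖x‖ ^ 2 * x.arg ^ 2)))) with hD
  -- Rotating the input by the phase of y₁ centres the angular density at 0, after which it depends
  -- only on `arg x` and ‖x‖.
  set u : ℂ := y.1 / ‖y.1‖ with hu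
  have hny : 0 < ‖y.1‖ := norm_pos_iff.2 hy
  have hnu : ‖u‖ = 1 := by
    rw [hu, norm_div, Complex.norm_real, norm_norm, div_self hny.ne']
  rw [complexGaussian_eq_withDensity one_ne_zero,
    lintegral_withDensity_eq_lintegral_mul _ (by fun_prop) hm, ← lintegral_comp_mul_unit hnu]
  have e1 : ∀ x : ℂ, ((fun x : ℂ => ENNReal.ofReal ((Real.pi * ((1 : ℝ≥0) : ℝ))⁻¹
      * Real.exp (-(‖x‖ ^ 2 / ((1 : ℝ≥0) : ℝ))))) * fun x =>
      ENNReal.ofReal (posteriorRatio σ₂ t B (x, y))) (x * u) = D x := by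
    intro x
    have harg : (x * u * (starRingEnd ℂ) y.1).arg = x.arg := by
      have : x * u * (starRingEnd ℂ) y.1 = (‖y.1‖ : ℝ) * x := by
        have h1 : (‖y.1‖ : ℂ) ≠ 0 := by exact_mod_cast hny.ne'
        have h2 : y.1 * (starRingEnd ℂ) y.1 = (‖y.1‖ : ℂ) ^ 2 := by
          rw [Complex.mul_conj, Complex.normSq_eq_norm_sq]
          push_cast
          rfl
        rw [hu, mul_div_assoc', div_mul_eq_mul_div, mul_assoc, h2]
        field_simp
      rw [this, Complex.arg_real_mul _ hny]
    simp only [Pi.mul_apply]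
    rw [← ENNReal.ofReal_mul (by positivity), hD]
    simp only [posteriorRatio]
    rw [harg, norm_mul, hnu, mul_one, ← hp]
    congr 1
    have hpi : √Real.pi * √Real.pi = Real.pi := Real.mul_self_sqrt Real.pi_pos.le
    have hexp : Real.exp (-‖x‖ ^ 2) * Real.exp (‖x‖ ^ 2) = 1 := by
      rw [← Real.exp_add]; simp
    have hsp : 0 < √Real.pi := Real.sqrt_pos.2 Real.pi_pos
    have hpi' : Real.pi⁻¹ * √Real.pi = 1 / √Real.pi := by
      nth_rewrite 1 [← hpi]
      field_simp
    simp only [NNReal.coe_one, mul_one, div_one]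
    calc _ = 2 * B * t * (Real.pi⁻¹ * √Real.pi) * (Real.exp (-‖x‖ ^ 2) * Real.exp (‖x‖ ^ 2))
          * (‖x‖ * p (y.2 - B * ‖x‖ ^ 2) * Real.exp (-(t ^ 2 * ‖x‖ ^ 2 * x.arg ^ 2))) := by ring
      _ = _ := by rw [hpi', hexp]; ring
  rw [lintegral_congr e1, ← Complex.lintegral_comp_polarCoord_symm, polarCoord_target,
    Measure.volume_eq_prod, ← Measure.prod_restrict, lintegral_prod]
  swap
  · have hDm : Measurable D := by
      have := measurable_gaussianPDFReal 0 (σ₂ ^ 2)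
      have := Complex.measurable_arg
      rw [hD, hp]
      fun_prop
    have : Measurable fun p : ℝ × ℝ => (Complex.polarCoord.symm p : ℂ) := by
      simp only [Complex.polarCoord_symm_apply]
      fun_prop
    exact Measurable.aemeasurable (Measurable.mul (by fun_prop) (hDm.comp this))
  have e2 : ∀ r ∈ Set.Ioi (0 : ℝ), ∫⁻ θ in Set.Ioo (-Real.pi) Real.pi,
      ENNReal.ofReal (r, θ).1 • D (Complex.polarCoord.symm (r, θ))
      ≤ ENNReal.ofReal (2 * B * r) * ENNReal.ofReal (p (y.2 - B * r ^ 2)) := by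
    intro r hr
    have hr0 : 0 < r := hr
    have e3 : ∀ θ ∈ Set.Ioo (-Real.pi) Real.pi,
        ENNReal.ofReal (r, θ).1 • D (Complex.polarCoord.symm (r, θ))
        = ENNReal.ofReal (r * (2 * B * t / √Real.pi * (r * p (y.2 - B * r ^ 2))))
          * ENNReal.ofReal (Real.exp (-(t ^ 2 * r ^ 2 * θ ^ 2))) := by
      intro θ hθ
      have hn : ‖(Complex.polarCoord.symm (r, θ) : ℂ)‖ = r := by
        rw [Complex.norm_polarCoord_symm, abs_of_pos hr0]
      have ha : (Complex.polarCoord.symm (r, θ) : ℂ).arg = θ := by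
        rw [Complex.polarCoord_symm_apply]
        push_cast
        exact Complex.arg_mul_cos_add_sin_mul_I hr0 ⟨hθ.1, hθ.2.le⟩
      have := hp0 (y.2 - B * r ^ 2)
      rw [hD, smul_eq_mul]
      simp only [hn, ha]
      rw [← ENNReal.ofReal_mul hr0.le, ← ENNReal.ofReal_mul (by positivity)]
      congr 1
      ring
    rw [setLIntegral_congr_fun measurableSet_Ioo e3, lintegral_const_mul _ (by fun_prop)]
    have := hp0 (y.2 - B * r ^ 2)
    calc _ ≤ ENNReal.ofReal (r * (2 * B * t / √Real.pi * (r * p (y.2 - B * r ^ 2))))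
          * ENNReal.ofReal √(Real.pi / (t ^ 2 * r ^ 2)) := by
            gcongr
            exact lintegral_exp_neg_mul_sq_le (by positivity) _
      _ = _ := by
        rw [← ENNReal.ofReal_mul (by positivity), ← ENNReal.ofReal_mul (by positivity),
          Real.sqrt_div Real.pi_pos.le, ← mul_pow, Real.sqrt_sq (by positivity)]
        congr 1
        have hsp : 0 < √Real.pi := Real.sqrt_pos.2 Real.pi_pos
        field_simp
  calc _ ≤ ∫⁻ r in Set.Ioi (0 : ℝ),
        ENNReal.ofReal (2 * B * r) * ENNReal.ofReal (p (y.2 - B * r ^ 2)) :=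
        setLIntegral_mono' measurableSet_Ioi e2
    _ ≤ 1 := lintegral_mul_comp_sq_le (f := fun s => ENNReal.ofReal (p s)) B y.2 hB
        (lintegral_gaussianPDFReal_eq_one 0 hσ₂2).le

/-- In the mean log posterior ratio, log ‖X‖ contributes −γ/2, the inverse prior +1 and the power
noise −1/2. The surplus 1/2 is cancelled in the limit by half the mean phase error. -/
theorem le_channelInfo {σ₁ σ₂ : ℝ≥0} (hσ₁ : 0 < σ₁) (hσ₂ : 0 < σ₂) {A B : ℝ} (hA : 0 < A)
    (hB : 0 < B) :
    Real.log (√2 * A * B / (σ₁ * σ₂)) - Real.eulerMascheroniConstant / 2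
      + (1 - ∫ p : ℂ × ℂ, phaseError (A / σ₁) p.1 p.2
        ∂((complexGaussian 1).prod (complexGaussian 1))) / 2
      ≤ (channelInfo σ₁ σ₂ A B).toReal := by
  have h1 : (0 : ℝ) < σ₁ := hσ₁
  have h2 : (0 : ℝ) < σ₂ := hσ₂
  set t := A / σ₁ with ht
  have ht0 : 0 < t := by positivity
  have hJac : jointLaw σ₁ σ₂ A B ≪ (complexGaussian 1).prod volume := by
    rw [jointLaw_eq_withDensity hσ₁ hσ₂]
    exact withDensity_absolutelyContinuous _ _
  have hx : ∀ᵐ z ∂(jointLaw σ₁ σ₂ A B), z.1 ≠ 0 :=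
    hJac.ae_le (Measure.quasiMeasurePreserving_fst.ae ae_ne_zero_complexGaussian)
  have hy0 : ∀ᵐ y : ℂ × ℝ, y.1 ≠ 0 := by
    rw [Measure.volume_eq_prod]
    exact Measure.quasiMeasurePreserving_fst.ae (compl_mem_ae_iff.2 (measure_singleton (0 : ℂ)))
  have hy1 : ∀ᵐ z ∂(jointLaw σ₁ σ₂ A B), z.2.1 ≠ 0 :=
    hJac.ae_le ((Measure.quasiMeasurePreserving_snd (μ := complexGaussian 1)).ae hy0)
  have hy : ∀ᵐ y ∂((jointLaw σ₁ σ₂ A B).map Prod.snd), y.1 ≠ 0 := by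
    rw [ae_map_iff measurable_snd.aemeasurable]
    · exact hy1
    · exact (measurableSet_singleton (0 : ℂ)).compl.preimage measurable_fst
  have hprob := Measure.isProbabilityMeasure_map (μ := jointLaw σ₁ σ₂ A B)
    measurable_snd.aemeasurable
  have hgm := measurable_posteriorRatio σ₂ t B
  have hσ₂2 : (0 : ℝ≥0) < σ₂ ^ 2 := by positivity
  have hsp : 0 < √Real.pi := Real.sqrt_pos.2 Real.pi_pos
  have hpos : ∀ᵐ z ∂(jointLaw σ₁ σ₂ A B), 0 < posteriorRatio σ₂ t B z := by
    filter_upwards [hx] with z hz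
    have : 0 < ‖z.1‖ := norm_pos_iff.2 hz
    have := gaussianPDFReal_pos 0 (σ₂ ^ 2) (z.2.2 - B * ‖z.1‖ ^ 2) hσ₂2.ne'
    unfold posteriorRatio
    positivity
  have hg1 : ∫⁻ z, ENNReal.ofReal (posteriorRatio σ₂ t B z)
      ∂((complexGaussian 1).prod ((jointLaw σ₁ σ₂ A B).map Prod.snd)) ≤ 1 := by
    rw [lintegral_prod_symm _ (by fun_prop)]
    calc _ ≤ ∫⁻ _, 1 ∂((jointLaw σ₁ σ₂ A B).map Prod.snd) := by
          refine lintegral_mono_ae (hy.mono fun y hy => ?_)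
          exact lintegral_posteriorRatio_le hσ₂ ht0 hB hy
      _ = 1 := by simp
  set f : ℂ × (ℂ × ℝ) → ℝ := fun w =>
    Real.log (2 * √Real.pi * B * t) - Real.log (2 * Real.pi * σ₂ ^ 2) / 2
      + Real.log (‖w.1‖ ^ 2) / 2 + ‖w.1‖ ^ 2 - w.2.2 ^ 2 / (2 * σ₂ ^ 2)
      - phaseError t w.1 w.2.1 / 2 with hf
  have hxs : ∀ᵐ w ∂(sourceLaw σ₂), w.1 ≠ 0 :=
    Measure.quasiMeasurePreserving_fst.ae ae_ne_zero_complexGaussian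
  have key : ∀ᵐ w ∂(sourceLaw σ₂),
      Real.log (posteriorRatio σ₂ t B (channelMap σ₁ A B w)) = f w := by
    filter_upwards [hxs] with w hw
    have hn : 0 < ‖w.1‖ := norm_pos_iff.2 hw
    have harg : (w.1 * (starRingEnd ℂ) ((A : ℂ) * w.1 + (σ₁ : ℝ) * w.2.1)).arg
        = (w.1 * (starRingEnd ℂ) (t * w.1 + w.2.1)).arg := by
      rw [← Complex.arg_real_mul (w.1 * (starRingEnd ℂ) (t * w.1 + w.2.1)) h1]
      congr 1
      have : (A : ℂ) = (σ₁ : ℝ) * t := by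
        rw [ht]; push_cast
        have : ((σ₁ : ℝ) : ℂ) ≠ 0 := by exact_mod_cast h1.ne'
        field_simp
      rw [this]
      simp only [map_add, map_mul, Complex.conj_ofReal]
      ring
    have hpd := gaussianPDFReal_pos 0 (σ₂ ^ 2) w.2.2 hσ₂2.ne'
    obtain ⟨C, hC0, hC⟩ : ∃ C, 0 < C ∧ C = 2 * √Real.pi * B * t := ⟨_, by positivity, rfl⟩
    simp only [posteriorRatio, channelMap, add_sub_cancel_left, harg]
    rw [← hC, Real.log_mul (by positivity) (by positivity), Real.log_mul (by positivity) (by positivity),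
      Real.log_mul (by positivity) (by positivity), Real.log_mul (by positivity) (by positivity),
      Real.log_exp, Real.log_exp, log_gaussianPDFReal _ hσ₂2, hf, hC]
    simp only [phaseError, Real.log_pow]
    push_cast
    ring
  have i1 : Integrable (fun w : ℂ × (ℂ × ℝ) => Real.log (‖w.1‖ ^ 2) / 2) (sourceLaw σ₂) :=
    (integrable_log_norm_sq_complexGaussian.comp_fst _).div_const 2
  have i2 : Integrable (fun w : ℂ × (ℂ × ℝ) => ‖w.1‖ ^ 2) (sourceLaw σ₂) :=
    (integrable_norm_pow_complexGaussian 2).comp_fst _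
  have i3 : Integrable (fun w : ℂ × (ℂ × ℝ) => w.2.2 ^ 2 / (2 * (σ₂ : ℝ) ^ 2)) (sourceLaw σ₂) :=
    (((integrable_sq_gaussianReal _).comp_snd _).comp_snd _).div_const _
  have hproj : MeasurePreserving (fun w : ℂ × (ℂ × ℝ) => (w.1, w.2.1)) (sourceLaw σ₂)
      ((complexGaussian 1).prod (complexGaussian 1)) :=
    (MeasurePreserving.id _).prod measurePreserving_fst
  have i4' := integrable_phaseError ht0
  have i4 : Integrable (fun w : ℂ × (ℂ × ℝ) => phaseError t w.1 w.2.1 / 2) (sourceLaw σ₂) :=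
    (hproj.integrable_comp_of_integrable i4').div_const 2
  set c := Real.log (2 * √Real.pi * B * t) - Real.log (2 * Real.pi * σ₂ ^ 2) / 2 with hc
  have k1 : Integrable (fun w : ℂ × (ℂ × ℝ) => c + Real.log (‖w.1‖ ^ 2) / 2) (sourceLaw σ₂) :=
    (integrable_const c).add i1
  have k2 : Integrable (fun w : ℂ × (ℂ × ℝ) => c + Real.log (‖w.1‖ ^ 2) / 2 + ‖w.1‖ ^ 2)
      (sourceLaw σ₂) := k1.add i2
  have k3 : Integrable (fun w : ℂ × (ℂ × ℝ) => c + Real.log (‖w.1‖ ^ 2) / 2 + ‖w.1‖ ^ 2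
      - w.2.2 ^ 2 / (2 * (σ₂ : ℝ) ^ 2)) (sourceLaw σ₂) := k2.sub i3
  have hfi : Integrable f (sourceLaw σ₂) := k3.sub i4
  have n1 : ∫ w : ℂ × (ℂ × ℝ), Real.log (‖w.1‖ ^ 2) / 2 ∂(sourceLaw σ₂)
      = -Real.eulerMascheroniConstant / 2 := by
    rw [sourceLaw, integral_fun_fst (fun x : ℂ => Real.log (‖x‖ ^ 2) / 2), integral_div,
      integral_log_norm_sq_complexGaussian]
    simp
  have n2 : ∫ w : ℂ × (ℂ × ℝ), ‖w.1‖ ^ 2 ∂(sourceLaw σ₂) = 1 := by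
    rw [sourceLaw, integral_fun_fst (fun y : ℂ => ‖y‖ ^ 2), integral_norm_sq_complexGaussian]
    simp
  have n3 : ∫ w : ℂ × (ℂ × ℝ), w.2.2 ^ 2 / (2 * (σ₂ : ℝ) ^ 2) ∂(sourceLaw σ₂) = 1 / 2 := by
    rw [sourceLaw, integral_fun_snd (fun y : ℂ × ℝ => y.2 ^ 2 / (2 * (σ₂ : ℝ) ^ 2)),
      integral_fun_snd (fun y : ℝ => y ^ 2 / (2 * (σ₂ : ℝ) ^ 2)), integral_div,
      integral_sq_gaussianReal]
    simp
    field_simp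
  have n4 : ∫ w : ℂ × (ℂ × ℝ), phaseError t w.1 w.2.1 / 2 ∂(sourceLaw σ₂)
      = (∫ p : ℂ × ℂ, phaseError t p.1 p.2
        ∂((complexGaussian 1).prod (complexGaussian 1))) / 2 := by
    rw [integral_div, ← integral_comp_measurePreserving hproj i4'.aestronglyMeasurable]
  have hfint : ∫ w, f w ∂(sourceLaw σ₂) = c - Real.eulerMascheroniConstant / 2 + 1 - 1 / 2
      - (∫ p : ℂ × ℂ, phaseError t p.1 p.2
        ∂((complexGaussian 1).prod (complexGaussian 1))) / 2 := by
    rw [hf, integral_sub k3 i4, integral_sub k2 i3, integral_add k1 i2,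
      integral_add (integrable_const c) i1, n1, n2, n3, n4]
    simp
    ring
  have hcv : c = Real.log (√2 * A * B / (σ₁ * σ₂)) := by
    have e1 : Real.log (2 * Real.pi * σ₂ ^ 2) / 2 = Real.log (√2 * √Real.pi * σ₂) := by
      rw [← Real.log_sqrt (by positivity), Real.sqrt_mul (by positivity),
        Real.sqrt_mul (by positivity), Real.sqrt_sq h2.le]
    rw [hc, e1, ← Real.log_div (by positivity) (by positivity), ht]
    congr 1
    have : √2 * √2 = (2 : ℝ) := Real.mul_self_sqrt (by norm_num)
    field_simp
    linear_combination (-1 : ℝ) * this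
  have hlm : Measurable fun z => Real.log (posteriorRatio σ₂ t B z) := hgm.log
  have hi : Integrable (fun z => Real.log (posteriorRatio σ₂ t B z)) (jointLaw σ₁ σ₂ A B) := by
    rw [jointLaw_eq_map_sourceLaw, integrable_map_measure hlm.aestronglyMeasurable (by fun_prop)]
    exact hfi.congr (key.mono fun w hw => hw.symm)
  have hint : ∫ z, Real.log (posteriorRatio σ₂ t B z) ∂(jointLaw σ₁ σ₂ A B)
      = ∫ w, f w ∂(sourceLaw σ₂) := by
    rw [jointLaw_eq_map_sourceLaw, integral_map (by fun_prop) hlm.aestronglyMeasurable]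
    exact integral_congr_ae key
  -- The variational bound concerns the real value of the divergence, so finiteness is needed; it
  -- comes from the upper bound.
  have hfin : channelInfo σ₁ σ₂ A B ≠ ∞ :=
    ((channelInfo_le hσ₁ hσ₂ A B).trans_lt ENNReal.ofReal_lt_top).ne
  have := integral_log_le_klDiv hfin hgm hpos hg1 hi
  rw [hint, hfint, hcv] at this
  rw [channelInfo]
  linarith

end LowerBound

/-! ### High-SNR expansion of the information. -/

section HighSNR

/-- For 0 < η < 1 the integrand lies between log ‖x‖² and ‖x‖², so convergence is dominated despite
the singularity at 0. -/
theorem tendsto_integral_log_add_norm_sq :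
    Tendsto (fun η : ℝ => ∫ x, Real.log (η + ‖x‖ ^ 2) ∂(complexGaussian 1)) (𝓝[>] 0)
      (𝓝 (-Real.eulerMascheroniConstant)) := by
  rw [← integral_log_norm_sq_complexGaussian]
  refine tendsto_integral_filter_of_dominated_convergence
    (fun x => |Real.log (‖x‖ ^ 2)| + ‖x‖ ^ 2)
    (Eventually.of_forall fun η => Measurable.aestronglyMeasurable (by fun_prop)) ?_
    (integrable_log_norm_sq_complexGaussian.abs.add (integrable_norm_pow_complexGaussian 2)) ?_
  · have h1 : ∀ᶠ η : ℝ in 𝓝[>] 0, η < 1 :=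
      mem_nhdsWithin_of_mem_nhds (gt_mem_nhds one_pos)
    filter_upwards [h1, self_mem_nhdsWithin] with η hη1 hη0
    filter_upwards [ae_ne_zero_complexGaussian] with x hx
    have hη : 0 < η := hη0
    have hn : 0 < ‖x‖ ^ 2 := by have := norm_pos_iff.2 hx; positivity
    have h2 : Real.log (‖x‖ ^ 2) ≤ Real.log (η + ‖x‖ ^ 2) := Real.log_le_log hn (by linarith)
    have h3 := Real.log_le_sub_one_of_pos (show 0 < η + ‖x‖ ^ 2 by positivity)
    rw [Real.norm_eq_abs, abs_le]
    constructor
    · linarith [neg_abs_le (Real.log (‖x‖ ^ 2))]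
    · linarith [abs_nonneg (Real.log (‖x‖ ^ 2))]
  · filter_upwards [ae_ne_zero_complexGaussian] with x hx
    have hn : ‖x‖ ^ 2 ≠ 0 := by have := norm_ne_zero_iff.2 hx; positivity
    have h : Tendsto (fun η : ℝ => η + ‖x‖ ^ 2) (𝓝[>] 0) (𝓝 (‖x‖ ^ 2)) := by
      have : Tendsto (fun η : ℝ => η + ‖x‖ ^ 2) (𝓝 0) (𝓝 (0 + ‖x‖ ^ 2)) :=
        (continuous_id.add continuous_const).tendsto 0
      rw [zero_add] at this
      exact this.mono_left nhdsWithin_le_nhds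
    exact h.log hn

theorem sq_le_condVar (σ₁ σ₂ : ℝ≥0) (A B : ℝ) (x : ℂ) : (σ₂ : ℝ) ^ 2 ≤ condVar σ₁ σ₂ A B x := by
  have := varNormSq_nonneg
  have h1 : 0 ≤ (B * (σ₁ ^ 2 / (A ^ 2 + σ₁ ^ 2))) ^ 2 * varNormSq := by positivity
  have h2 : 0 ≤ 2 * B ^ 2 * A ^ 2 * σ₁ ^ 2 / (A ^ 2 + σ₁ ^ 2) ^ 2 * ‖x‖ ^ 2 := by positivity
  unfold condVar
  linarith

theorem channelInfo_ne_top {σ₁ σ₂ : ℝ≥0} (hσ₁ : 0 < σ₁) (hσ₂ : 0 < σ₂) (A B : ℝ) :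
    channelInfo σ₁ σ₂ A B ≠ ∞ :=
  ((channelInfo_le hσ₁ hσ₂ A B).trans_lt ENNReal.ofReal_lt_top).ne

theorem toReal_channelInfo_le {σ₁ σ₂ : ℝ≥0} (hσ₁ : 0 < σ₁) (hσ₂ : 0 < σ₂) (A B : ℝ) :
    (channelInfo σ₁ σ₂ A B).toReal ≤ Real.log ((A ^ 2 + σ₁ ^ 2) / σ₁ ^ 2)
      + (∫ x, Real.log (condVar σ₁ σ₂ A B x / σ₂ ^ 2) ∂(complexGaussian 1)) / 2 := by
  have h1 : (0 : ℝ) < σ₁ := hσ₁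
  have h2 : (0 : ℝ) < σ₂ := hσ₂
  refine ENNReal.toReal_le_of_le_ofReal ?_ (channelInfo_le hσ₁ hσ₂ A B)
  refine add_nonneg (Real.log_nonneg ?_) (div_nonneg (integral_nonneg fun x => ?_) two_pos.le)
  · rw [le_div_iff₀ (by positivity)]
    nlinarith [sq_nonneg A]
  · refine Real.log_nonneg ?_
    rw [le_div_iff₀ (by positivity), one_mul]
    exact sq_le_condVar _ _ _ _ _

/-- Factoring the coefficient of ‖x‖² out of `condVar` yields exactly the leading logarithm. The
constant left beside ‖x‖² is of order 1/P when A² and B² grow like P and P². -/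
theorem toReal_channelInfo_le_of_pos {σ₁ σ₂ : ℝ≥0} (hσ₁ : 0 < σ₁) (hσ₂ : 0 < σ₂) {A B : ℝ}
    (hA : 0 < A) (hB : 0 < B) :
    (channelInfo σ₁ σ₂ A B).toReal ≤ Real.log (√2 * A * B / (σ₁ * σ₂))
      + (∫ x, Real.log ((σ₂ ^ 2 * (A ^ 2 + σ₁ ^ 2) ^ 2 / (2 * B ^ 2 * A ^ 2 * σ₁ ^ 2)
          + σ₁ ^ 2 * varNormSq / (2 * A ^ 2)) + ‖x‖ ^ 2) ∂(complexGaussian 1)) / 2 := by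
  have h1 : (0 : ℝ) < σ₁ := hσ₁
  have h2 : (0 : ℝ) < σ₂ := hσ₂
  have hv := varNormSq_nonneg
  refine (toReal_channelInfo_le hσ₁ hσ₂ A B).trans (le_of_eq ?_)
  set η := σ₂ ^ 2 * (A ^ 2 + σ₁ ^ 2) ^ 2 / (2 * B ^ 2 * A ^ 2 * σ₁ ^ 2)
    + σ₁ ^ 2 * varNormSq / (2 * A ^ 2) with hη
  have hη0 : 0 < η := by positivity
  set b := 2 * B ^ 2 * A ^ 2 * σ₁ ^ 2 / ((A ^ 2 + σ₁ ^ 2) ^ 2 * σ₂ ^ 2) with hb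
  have hb0 : 0 < b := by positivity
  have e (x : ℂ) : Real.log (condVar σ₁ σ₂ A B x / σ₂ ^ 2)
      = Real.log b + Real.log (η + ‖x‖ ^ 2) := by
    rw [← Real.log_mul hb0.ne' (by positivity)]
    congr 1
    rw [condVar, hb, hη]
    field_simp
  simp only [e]
  have hi : Integrable (fun x => Real.log (η + ‖x‖ ^ 2)) (complexGaussian 1) := by
    simpa using integrable_log_add_mul_norm_sq hη0 zero_le_one
  rw [integral_add (integrable_const _) hi]
  simp only [integral_const, probReal_univ, smul_eq_mul, one_mul]
  have e2 : Real.log ((A ^ 2 + σ₁ ^ 2) / σ₁ ^ 2) + Real.log b / 2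
      = Real.log (√2 * A * B / (σ₁ * σ₂)) := by
    have e3 : Real.log ((A ^ 2 + σ₁ ^ 2) / σ₁ ^ 2)
        = Real.log (((A ^ 2 + σ₁ ^ 2) / σ₁ ^ 2) ^ 2) / 2 := by rw [Real.log_pow]; ring
    have e4 : Real.log (√2 * A * B / (σ₁ * σ₂))
        = Real.log ((√2 * A * B / (σ₁ * σ₂)) ^ 2) / 2 := by rw [Real.log_pow]; ring
    rw [e3, e4, ← add_div, ← Real.log_mul (by positivity) hb0.ne']
    congr 2
    have e5 : √2 ^ 2 = (2 : ℝ) := Real.sq_sqrt two_pos.le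
    rw [hb]
    field_simp
    rw [e5]
  linarith

/-- High-SNR expansion when both branches are active. -/
theorem tendsto_channelInfo_sub_log {σ₁ σ₂ : ℝ≥0} (hσ₁ : 0 < σ₁) (hσ₂ : 0 < σ₂) {a b : ℝ}
    (ha : 0 < a) (hb : 0 < b) :
    Tendsto (fun P : ℝ => (channelInfo σ₁ σ₂ (√a * √P) (√b * P)).toReal
      - Real.log (√2 * (√a * √P) * (√b * P) / (σ₁ * σ₂))) atTop
      (𝓝 (-Real.eulerMascheroniConstant / 2)) := by
  have h1 : (0 : ℝ) < σ₁ := hσ₁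
  have h2 : (0 : ℝ) < σ₂ := hσ₂
  have hv := varNormSq_nonneg
  have hsa : 0 < √a := Real.sqrt_pos.2 ha
  have hsb : 0 < √b := Real.sqrt_pos.2 hb
  have hlow : Tendsto (fun P : ℝ => -Real.eulerMascheroniConstant / 2
      + (1 - ∫ p : ℂ × ℂ, phaseError (√a * √P / σ₁) p.1 p.2
        ∂((complexGaussian 1).prod (complexGaussian 1))) / 2) atTop
      (𝓝 (-Real.eulerMascheroniConstant / 2)) := by
    have ht : Tendsto (fun P : ℝ => √a * √P / σ₁) atTop atTop :=
      (Real.tendsto_sqrt_atTop.const_mul_atTop hsa).atTop_div_const h1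
    have := ((tendsto_integral_phaseError.comp ht).const_sub 1).div_const 2
    have := this.const_add (-Real.eulerMascheroniConstant / 2)
    simpa using this
  have hη : Tendsto (fun P : ℝ => (σ₂ : ℝ) ^ 2 / (2 * b * a * σ₁ ^ 2)
      * ((a + σ₁ ^ 2 * P⁻¹) ^ 2 * P⁻¹) + σ₁ ^ 2 * varNormSq / (2 * a) * P⁻¹) atTop (𝓝 0) := by
    have hi : Tendsto (fun P : ℝ => P⁻¹) atTop (𝓝 0) := tendsto_inv_atTop_zero
    have h3 := ((((hi.const_mul ((σ₁ : ℝ) ^ 2)).const_add a).pow 2).mul hi).const_mul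
      ((σ₂ : ℝ) ^ 2 / (2 * b * a * σ₁ ^ 2))
    have h4 := hi.const_mul ((σ₁ : ℝ) ^ 2 * varNormSq / (2 * a))
    simpa using h3.add h4
  have hη' : Tendsto (fun P : ℝ => (σ₂ : ℝ) ^ 2 / (2 * b * a * σ₁ ^ 2)
      * ((a + σ₁ ^ 2 * P⁻¹) ^ 2 * P⁻¹) + σ₁ ^ 2 * varNormSq / (2 * a) * P⁻¹) atTop (𝓝[>] 0) := by
    refine tendsto_nhdsWithin_iff.2 ⟨hη, ?_⟩
    filter_upwards [eventually_gt_atTop 0] with P hP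
    simp only [Set.mem_Ioi]
    positivity
  have hup := (tendsto_integral_log_add_norm_sq.comp hη').div_const 2
  refine tendsto_of_tendsto_of_tendsto_of_le_of_le' hlow hup ?_ ?_
  · filter_upwards [eventually_gt_atTop 0] with P hP
    have hsP : 0 < √P := Real.sqrt_pos.2 hP
    have := le_channelInfo hσ₁ hσ₂ (A := √a * √P) (B := √b * P) (by positivity) (by positivity)
    linarith
  · filter_upwards [eventually_gt_atTop 0] with P hP
    have hsP : 0 < √P := Real.sqrt_pos.2 hP
    have := toReal_channelInfo_le_of_pos hσ₁ hσ₂ (A := √a * √P) (B := √b * P) (by positivity)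
      (by positivity)
    have e : (σ₂ : ℝ) ^ 2 * ((√a * √P) ^ 2 + σ₁ ^ 2) ^ 2
          / (2 * (√b * P) ^ 2 * (√a * √P) ^ 2 * σ₁ ^ 2)
        + σ₁ ^ 2 * varNormSq / (2 * (√a * √P) ^ 2)
        = (σ₂ : ℝ) ^ 2 / (2 * b * a * σ₁ ^ 2)
      * ((a + σ₁ ^ 2 * P⁻¹) ^ 2 * P⁻¹) + σ₁ ^ 2 * varNormSq / (2 * a) * P⁻¹ := by
      simp only [mul_pow, Real.sq_sqrt ha.le, Real.sq_sqrt hb.le, Real.sq_sqrt hP.le]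
      field_simp
    rw [e] at this
    simp only [Function.comp]
    linarith

/-- When one of the two branches is inactive, the information grows at most like `log P`. -/
theorem exists_channelInfo_le_log_add {σ₁ σ₂ : ℝ≥0} (hσ₁ : 0 < σ₁) (hσ₂ : 0 < σ₂) {a b : ℝ}
    (ha : 0 ≤ a) (hb : 0 ≤ b) (hab : a * b = 0) :
    ∃ C : ℝ, ∀ P : ℝ, 1 ≤ P →
      (channelInfo σ₁ σ₂ (√a * √P) (√b * P)).toReal ≤ Real.log P + C := by
  have h1 : (0 : ℝ) < σ₁ := hσ₁
  have h2 : (0 : ℝ) < σ₂ := hσ₂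
  have hv := varNormSq_nonneg
  -- Without the coherent branch, `condVar` is a constant of order at most P² and half its logarithm
  -- is log P; without the power branch, only the coherent term, of order log P, survives.
  rcases mul_eq_zero.1 hab with rfl | rfl
  · refine ⟨Real.log (1 + b * varNormSq / σ₂ ^ 2) / 2, fun P hP => ?_⟩
    have hP0 : 0 < P := by linarith
    refine (toReal_channelInfo_le hσ₁ hσ₂ _ _).trans ?_
    have e (x : ℂ) : condVar σ₁ σ₂ 0 (√b * P) x / σ₂ ^ 2
        = 1 + b * varNormSq / σ₂ ^ 2 * P ^ 2 := by
      simp only [condVar, zero_mul, ne_eq, OfNat.ofNat_ne_zero, not_false_eq_true,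
        zero_pow, zero_add, mul_zero, zero_div, add_zero]
      rw [div_self (by positivity), mul_one, mul_pow, Real.sq_sqrt hb]
      field_simp
    simp only [Real.sqrt_zero, zero_mul]
    simp only [e, integral_const, probReal_univ, smul_eq_mul, one_mul]
    rw [show ((0 : ℝ) ^ 2 + (σ₁ : ℝ) ^ 2) / σ₁ ^ 2 = 1 by field_simp; simp, Real.log_one]
    have h3 : Real.log (1 + b * varNormSq / σ₂ ^ 2 * P ^ 2)
        ≤ Real.log ((1 + b * varNormSq / σ₂ ^ 2) * P ^ 2) := by
      refine Real.log_le_log (by positivity) ?_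
      nlinarith
    rw [Real.log_mul (by positivity) (by positivity), Real.log_pow] at h3
    push_cast at h3
    linarith
  · refine ⟨Real.log ((a + σ₁ ^ 2) / σ₁ ^ 2), fun P hP => ?_⟩
    have hP0 : 0 < P := by linarith
    refine (toReal_channelInfo_le hσ₁ hσ₂ _ _).trans ?_
    have e (x : ℂ) : condVar σ₁ σ₂ (√a * √P) (√0 * P) x / σ₂ ^ 2 = 1 := by
      simp only [condVar, Real.sqrt_zero, zero_mul, ne_eq, OfNat.ofNat_ne_zero, not_false_eq_true,
        zero_pow, mul_zero, zero_div, add_zero]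
      rw [div_self (by positivity)]
    simp only [e, Real.log_one, integral_zero, zero_div, add_zero]
    rw [mul_pow, Real.sq_sqrt ha, Real.sq_sqrt hP0.le,
      ← Real.log_mul (by positivity) (by positivity)]
    refine Real.log_le_log (by positivity) ?_
    rw [← mul_div_assoc]
    gcongr
    nlinarith

/-- The part of the high-SNR rate that does not depend on the split. -/
def baseRate (σ₁ σ₂ : ℝ) (P : ℝ) : ℝ :=
  Real.logb 2 (√2 * P ^ (3 / 2 : ℝ) / (σ₁ * σ₂))
    - Real.eulerMascheroniConstant / (2 * Real.log 2)

theorem logb_mul_sqrt {u v : ℝ} (hu : 0 < u) (hv : 0 < v) :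
    Real.logb 2 (u * √v) = Real.logb 2 u + Real.logb 2 v / 2 := by
  rw [Real.logb_mul hu.ne' (Real.sqrt_pos.2 hv).ne']
  simp only [Real.logb, Real.log_sqrt hv.le]
  ring

theorem mul_sqrt_mul_eq_rpow {P : ℝ} (hP : 0 < P) : √P * P = P ^ (3 / 2 : ℝ) := by
  rw [Real.sqrt_eq_rpow]
  nth_rewrite 2 [← Real.rpow_one P]
  rw [← Real.rpow_add hP]
  norm_num

theorem tendsto_bits_sub_baseRate {σ₁ σ₂ : ℝ≥0} (hσ₁ : 0 < σ₁) (hσ₂ : 0 < σ₂) {a b : ℝ}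
    (ha : 0 ≤ a) (hb : 0 ≤ b) (hab : 0 < a * b) :
    Tendsto (fun P : ℝ => (channelInfo σ₁ σ₂ (√a * √P) (√b * P)
      / ENNReal.ofReal (Real.log 2)).toReal - baseRate σ₁ σ₂ P) atTop
      (𝓝 (Real.logb 2 (a * b) / 2)) := by
  have h1 : (0 : ℝ) < σ₁ := hσ₁
  have h2 : (0 : ℝ) < σ₂ := hσ₂
  have ha' : 0 < a := lt_of_le_of_ne ha (by rintro rfl; simp at hab)
  have hb' : 0 < b := lt_of_le_of_ne hb (by rintro rfl; simp at hab)
  have hl2 : 0 < Real.log 2 := Real.log_pos one_lt_two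
  have h := ((tendsto_channelInfo_sub_log hσ₁ hσ₂ ha' hb').div_const (Real.log 2)).add_const
    (Real.logb 2 (a * b) / 2 + Real.eulerMascheroniConstant / (2 * Real.log 2))
  have hlim : -Real.eulerMascheroniConstant / 2 / Real.log 2
      + (Real.logb 2 (a * b) / 2 + Real.eulerMascheroniConstant / (2 * Real.log 2))
      = Real.logb 2 (a * b) / 2 := by field_simp; ring
  rw [hlim] at h
  refine h.congr' ?_
  filter_upwards [eventually_gt_atTop 0] with P hP
  have hP3 : 0 < P ^ (3 / 2 : ℝ) := by positivity
  have e : √2 * (√a * √P) * (√b * P) / (σ₁ * σ₂)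
      = √2 * P ^ (3 / 2 : ℝ) / (σ₁ * σ₂) * √(a * b) := by
    rw [Real.sqrt_mul ha, ← mul_sqrt_mul_eq_rpow hP]
    ring
  rw [ENNReal.toReal_div, ENNReal.toReal_ofReal hl2.le, sub_div, e, baseRate]
  have := logb_mul_sqrt (u := √2 * P ^ (3 / 2 : ℝ) / (σ₁ * σ₂)) (by positivity) hab
  change Real.log _ / Real.log 2 = _ at this
  rw [this]
  ring

theorem tendsto_bits_sub_baseRate_atBot {σ₁ σ₂ : ℝ≥0} (hσ₁ : 0 < σ₁) (hσ₂ : 0 < σ₂) {a b : ℝ}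
    (ha : 0 ≤ a) (hb : 0 ≤ b) (hab : a * b = 0) :
    Tendsto (fun P : ℝ => (channelInfo σ₁ σ₂ (√a * √P) (√b * P)
      / ENNReal.ofReal (Real.log 2)).toReal - baseRate σ₁ σ₂ P) atTop atBot := by
  have h1 : (0 : ℝ) < σ₁ := hσ₁
  have h2 : (0 : ℝ) < σ₂ := hσ₂
  have hl2 : 0 < Real.log 2 := Real.log_pos one_lt_two
  obtain ⟨C, hC⟩ := exists_channelInfo_le_log_add hσ₁ hσ₂ ha hb hab
  -- The information is at most log P + C while `baseRate` grows like (3/2) log P in nats; the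
  -- difference −½ log P drives the limit.
  have hlim : Tendsto (fun P : ℝ => (-(1 / 2 * Real.log P) + (C - Real.log (√2 / (σ₁ * σ₂))
      + Real.eulerMascheroniConstant / 2)) / Real.log 2) atTop atBot := by
    refine Tendsto.atBot_div_const hl2 (tendsto_atBot_add_const_right _ _ ?_)
    exact tendsto_neg_atTop_atBot.comp (Real.tendsto_log_atTop.const_mul_atTop (by norm_num))
  refine tendsto_atBot_mono' _ ?_ hlim
  filter_upwards [eventually_ge_atTop 1] with P hP
  have hP0 : 0 < P := by linarith
  have e : √2 * P ^ (3 / 2 : ℝ) / (σ₁ * σ₂) = √2 / (σ₁ * σ₂) * P ^ (3 / 2 : ℝ) := by ring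
  rw [ENNReal.toReal_div, ENNReal.toReal_ofReal hl2.le, baseRate, Real.logb, e,
    Real.log_mul (by positivity) (by positivity), Real.log_rpow hP0]
  rw [show Real.eulerMascheroniConstant / (2 * Real.log 2)
    = Real.eulerMascheroniConstant / 2 / Real.log 2 by field_simp, ← sub_div, ← sub_div]
  gcongr
  linarith [hC P hP]

end HighSNR

/-! ### From the high-SNR expansion to the optimal split. -/

section HalfSplit

/-- Continuity of the logarithm at 1, applied to u/v: closeness in relative error gives closeness of
logarithms, uniformly in the size of v. -/
theorem exists_logb_close {ε : ℝ} (hε : 0 < ε) :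
    ∃ κ : ℝ, 0 < κ ∧ κ < 1 ∧ ∀ u v : ℝ, 0 < v → |u - v| ≤ κ * v →
      |Real.logb 2 u / 2 - Real.logb 2 v / 2| < ε := by
  have hc : ContinuousAt (fun s => Real.logb 2 s / 2) 1 :=
    (Real.continuousAt_logb one_ne_zero).div_const 2
  obtain ⟨δ, hδ, h⟩ := Metric.continuousAt_iff.1 hc ε hε
  refine ⟨min (δ / 2) (1 / 2), by positivity, (min_le_right _ _).trans_lt (by norm_num),
    fun u v hv huv => ?_⟩
  have h1 : |u / v - 1| ≤ min (δ / 2) (1 / 2) := by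
    have : u / v - 1 = (u - v) / v := by field_simp
    rw [this, abs_div, abs_of_pos hv, div_le_iff₀ hv]
    exact huv
  have h2 := h (x := u / v) (by
    rw [Real.dist_eq]
    exact h1.trans_lt ((min_le_left _ _).trans_lt (by linarith)))
  have hu : 0 < u / v := by
    have := (abs_le.1 (h1.trans (min_le_right _ _))).1
    linarith
  have hu' : 0 < u := by
    have := mul_pos hu hv
    rwa [div_mul_cancel₀ _ hv.ne'] at this
  rw [Real.dist_eq, Real.logb_div hu'.ne' hv.ne'] at h2
  simp only [Real.logb_one, zero_div, sub_zero] at h2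
  rwa [← sub_div]

theorem splitRate_eq {σ₁ σ₂ c : ℝ} (hσ₁ : 0 < σ₁) (hσ₂ : 0 < σ₂) {K K₁ : ℕ}
    (hT : 0 < (K₁ : ℝ) * (K - K₁) * c) {P : ℝ} (hP : 0 < P) :
    splitRate σ₁ σ₂ c K K₁ P
      = baseRate σ₁ σ₂ P + Real.logb 2 ((K₁ : ℝ) * (K - K₁) * c) / 2 := by
  have : √2 * P ^ (3 / 2 : ℝ) * √((K₁ : ℝ) * ((K : ℝ) - K₁) * c) / (σ₁ * σ₂)
      = √2 * P ^ (3 / 2 : ℝ) / (σ₁ * σ₂) * √((K₁ : ℝ) * ((K : ℝ) - K₁) * c) := by ring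
  rw [splitRate, baseRate, this, logb_mul_sqrt (by positivity) hT]
  ring

theorem maxRate_eq {σ₁ σ₂ c : ℝ} (hσ₁ : 0 < σ₁) (hσ₂ : 0 < σ₂) (hc : 0 < c) {K : ℕ}
    (hK : 0 < K) {P : ℝ} (hP : 0 < P) :
    maxRate σ₁ σ₂ c K P = baseRate σ₁ σ₂ P + Real.logb 2 (c / 4 * (K : ℝ) ^ 2) / 2 := by
  have hK' : (0 : ℝ) < K := by exact_mod_cast hK
  have : (K : ℝ) * P ^ (3 / 2 : ℝ) * √c / (√2 * σ₁ * σ₂)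
      = √2 * P ^ (3 / 2 : ℝ) / (σ₁ * σ₂) * √(c / 4 * (K : ℝ) ^ 2) := by
    have h4 : √(4 : ℝ) = 2 := by
      rw [show (4 : ℝ) = 2 ^ 2 by norm_num, Real.sqrt_sq two_pos.le]
    rw [Real.sqrt_mul (by positivity), Real.sqrt_div hc.le, Real.sqrt_sq hK'.le, h4]
    have : √2 * √2 = (2 : ℝ) := Real.mul_self_sqrt two_pos.le
    have h2 : 0 < √2 := Real.sqrt_pos.2 two_pos
    field_simp
    linear_combination (-1 : ℝ) * this
  rw [maxRate, baseRate, this, logb_mul_sqrt (by positivity) (by positivity)]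
  ring

/-- High-SNR behaviour of a family of informations: up to a common function `R` of the power, the
`K₁`-th one tends to `log₂ (T K K₁) / 2`, which is `-∞` if `T K K₁ = 0`. -/
structure HighSNRExpansion (I : ℕ → ℕ → ℝ → ℝ≥0∞) (R : ℝ → ℝ) (T : ℕ → ℕ → ℝ) : Prop where
  ne_top : ∀ K K₁ P, 0 < P → I K K₁ P ≠ ∞
  nonneg : ∀ K K₁, K₁ ≤ K → 0 ≤ T K K₁
  tendsto : ∀ K K₁, K₁ ≤ K → 0 < T K K₁ →
    Tendsto (fun P => (I K K₁ P).toReal - R P) atTop (𝓝 (Real.logb 2 (T K K₁) / 2))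
  tendsto_atBot : ∀ K K₁, K₁ ≤ K → T K K₁ = 0 →
    Tendsto (fun P => (I K K₁ P).toReal - R P) atTop atBot

/-- The common function R cancels, leaving a comparison of limits. Where T vanishes the limit is −∞,
so the comparison of logarithms is required only for positive T. -/
theorem HighSNRExpansion.eventually_lt {I : ℕ → ℕ → ℝ → ℝ≥0∞} {R : ℝ → ℝ} {T : ℕ → ℕ → ℝ}
    (h : HighSNRExpansion I R T) {K i j : ℕ} (hi : i ≤ K) (hj : j ≤ K) (hTj : 0 < T K j) {s : ℝ}
    (hs : 0 < T K i → Real.logb 2 (T K i) / 2 < Real.logb 2 (T K j) / 2 + s) :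
    ∀ᶠ P in atTop, (I K i P).toReal < (I K j P).toReal + s := by
  have hJ := h.tendsto K j hj hTj
  rcases (h.nonneg K i hi).eq_or_lt with h0 | h0
  · filter_upwards [(h.tendsto_atBot K i hi h0.symm).eventually_lt_atBot
      (Real.logb 2 (T K j) / 2 - 1 + s), hJ.eventually_const_lt (sub_one_lt _)] with P h1 h2
    linarith
  · have hI := h.tendsto K i hi h0
    obtain ⟨r, hr1, hr2⟩ := exists_between (hs h0)
    filter_upwards [hI.eventually_lt_const hr1,
      hJ.eventually_const_lt (show r - s < Real.logb 2 (T K j) / 2 by linarith)] with P h1 h2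
    linarith

theorem HighSNRExpansion.eventually_abs_lt {I : ℕ → ℕ → ℝ → ℝ≥0∞} {R : ℝ → ℝ}
    {T : ℕ → ℕ → ℝ} (h : HighSNRExpansion I R T) {K i : ℕ} (hi : i ≤ K) (hT : 0 < T K i)
    {l s : ℝ} (hs : |Real.logb 2 (T K i) / 2 - l| < s) :
    ∀ᶠ P in atTop, |(I K i P).toReal - (R P + l)| < s := by
  have h1 := ((h.tendsto K i hi hT).sub_const l).abs
  filter_upwards [h1.eventually_lt_const hs] with P hP
  rwa [sub_sub] at hP

-- All claims reduce to estimates of T at fixed K, since finitely many K₁ share one threshold in P.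
-- The error δK² is small relative to the maximum cK²/4, and also relative to both the deficit and
-- the value of c·K₁(K − K₁) on the ranges cut out by ε.
set_option maxHeartbeats 1000000 in
theorem HighSNRExpansion.halfSplitOptimal {σ₁ σ₂ c : ℝ} (hσ₁ : 0 < σ₁) (hσ₂ : 0 < σ₂)
    (hc : 0 < c) {I : ℕ → ℕ → ℝ → ℝ≥0∞} {T : ℕ → ℕ → ℝ}
    (h : HighSNRExpansion I (baseRate σ₁ σ₂) T)
    (hT : ∀ δ : ℝ, 0 < δ → ∀ᶠ K : ℕ in atTop, ∀ K₁ ≤ K,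
      |T K K₁ - c * (K₁ * (K - K₁))| ≤ δ * (K : ℝ) ^ 2) :
    HalfSplitOptimal σ₁ σ₂ c I := by
  intro ε hε
  obtain ⟨κ, hκ0, hκ1, hκ⟩ := exists_logb_close (show 0 < ε / 4 by positivity)
  -- The first condition keeps T at the half split within relative error κ of cK²/4. The second
  -- makes the deficit cε²K² of an unbalanced split exceed the total error 3δK², and controls the
  -- relative error where K₁(K − K₁) ≥ ε²K².
  obtain ⟨δ, hδ0, hδ1, hδ2⟩ : ∃ δ : ℝ, 0 < δ ∧ 2 * δ ≤ κ * (c / 4) ∧ 4 * δ ≤ κ * (c * ε ^ 2) := by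
    refine ⟨min (κ * (c / 4) / 2) (κ * (c * ε ^ 2) / 4), by positivity, ?_, ?_⟩
    · linarith [min_le_left (κ * (c / 4) / 2) (κ * (c * ε ^ 2) / 4)]
    · linarith [min_le_right (κ * (c / 4) / 2) (κ * (c * ε ^ 2) / 4)]
  -- For K ≥ c/δ, rounding K/2 down costs at most c/4 ≤ δK².
  obtain ⟨n, hn⟩ := exists_nat_ge (c / δ)
  filter_upwards [hT δ hδ0, eventually_ge_atTop 2, eventually_ge_atTop n] with K hK hK2 hKn
  have hK0 : (0 : ℝ) < K := by
    have : 0 < K := by omega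
    exact_mod_cast this
  have hKsq : (0 : ℝ) < (K : ℝ) ^ 2 := by positivity
  set m := K / 2 with hm
  have hmK : m ≤ K := Nat.div_le_self _ _
  have hmI : m ∈ Finset.Ico 1 K := by rw [Finset.mem_Ico]; omega
  -- the half split is nearly balanced
  have hmbal : (1 / 4 : ℝ) * (K : ℝ) ^ 2 - 1 / 4 ≤ m * (K - m) := by
    have h1 : (K : ℝ) = 2 * m ∨ (K : ℝ) = 2 * m + 1 := by
      rcases Nat.even_or_odd' K with ⟨k, hk | hk⟩
      · left; have : K = 2 * m := by omega
        exact_mod_cast this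
      · right; have : K = 2 * m + 1 := by omega
        exact_mod_cast this
    rcases h1 with h1 | h1 <;> rw [h1] <;> nlinarith
  have hcδ : c * (1 / 4) ≤ δ * (K : ℝ) ^ 2 := by
    have h1 : c ≤ δ * K := by
      have : c / δ ≤ K := hn.trans (by exact_mod_cast hKn)
      rw [div_le_iff₀ hδ0] at this
      linarith
    have h2 : (1 : ℝ) ≤ K := by
      have : 1 ≤ K := by omega
      exact_mod_cast this
    nlinarith [mul_pos hδ0 hK0]
  have hTle (K₁ : ℕ) (h1 : K₁ ≤ K) : T K K₁ ≤ (c / 4 + δ) * (K : ℝ) ^ 2 := by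
    have := (abs_le.1 (hK K₁ h1)).2
    have h2 : (K₁ : ℝ) * (K - K₁) ≤ (K : ℝ) ^ 2 / 4 := by nlinarith [sq_nonneg ((K : ℝ) - 2 * K₁)]
    nlinarith
  have hTm : (c / 4 - 2 * δ) * (K : ℝ) ^ 2 ≤ T K m := by
    have := (abs_le.1 (hK m hmK)).1
    nlinarith
  have hTm0 : 0 < T K m := by
    refine lt_of_lt_of_le ?_ hTm
    have : 0 < c / 4 - 2 * δ := by nlinarith
    positivity
  have hTmclose : |T K m - c / 4 * (K : ℝ) ^ 2| ≤ κ * (c / 4 * (K : ℝ) ^ 2) := by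
    have h1 := hTle m hmK
    have h2 : 2 * δ * (K : ℝ) ^ 2 ≤ κ * (c / 4) * (K : ℝ) ^ 2 := by gcongr
    have h3 : 0 ≤ δ * (K : ℝ) ^ 2 := by positivity
    rw [abs_le]
    constructor <;> nlinarith
  have hlm := hκ _ _ (by positivity) hTmclose
  have hcmp : ∀ K₁ ∈ Finset.Ico 1 K, ∀ᶠ P in atTop,
      (I K K₁ P).toReal < (I K m P).toReal + ε / 2 := by
    intro K₁ hK₁
    rw [Finset.mem_Ico] at hK₁
    refine h.eventually_lt hK₁.2.le hmK hTm0 fun h0 => ?_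
    have h1 : Real.logb 2 (T K K₁) ≤ Real.logb 2 ((c / 4 + δ) * (K : ℝ) ^ 2) :=
      Real.logb_le_logb_of_le one_lt_two h0 (hTle K₁ hK₁.2.le)
    have h2 := hκ ((c / 4 + δ) * (K : ℝ) ^ 2) (c / 4 * (K : ℝ) ^ 2) (by positivity) (by
      have : (c / 4 + δ) * (K : ℝ) ^ 2 - c / 4 * (K : ℝ) ^ 2 = δ * (K : ℝ) ^ 2 := by ring
      rw [this, abs_of_pos (by positivity), ← mul_assoc]
      gcongr
      linarith)
    linarith [(abs_lt.1 hlm).1, (abs_lt.1 h2).2]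
  have hstrict : ∀ K₁ ∈ Finset.Ico 1 K, ε < |(K₁ : ℝ) / K - 1 / 2| → ∀ᶠ P in atTop,
      (I K K₁ P).toReal < (I K m P).toReal := by
    intro K₁ hK₁ hfar
    rw [Finset.mem_Ico] at hK₁
    have key : T K K₁ < T K m := by
      refine lt_of_lt_of_le ?_ hTm
      have h1 := (abs_le.1 (hK K₁ hK₁.2.le)).2
      have h2 : ε ^ 2 < ((K₁ : ℝ) / K - 1 / 2) ^ 2 := by
        rw [← sq_abs ((K₁ : ℝ) / K - 1 / 2)]
        gcongr
      have h3 : ε ^ 2 * (K : ℝ) ^ 2 < (K₁ - K / 2 : ℝ) ^ 2 := by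
        have : (K₁ - K / 2 : ℝ) = ((K₁ : ℝ) / K - 1 / 2) * K := by field_simp
        rw [this, mul_pow]
        gcongr
      have h5 : c * (ε ^ 2 * (K : ℝ) ^ 2) < c * (K₁ - K / 2 : ℝ) ^ 2 := by gcongr
      have h6 : κ * (c * ε ^ 2) * (K : ℝ) ^ 2 ≤ 1 * (c * ε ^ 2) * (K : ℝ) ^ 2 := by gcongr
      have h7 : 4 * δ * (K : ℝ) ^ 2 ≤ κ * (c * ε ^ 2) * (K : ℝ) ^ 2 := by gcongr
      have h8 : 0 < δ * (K : ℝ) ^ 2 := by positivity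
      nlinarith
    have := h.eventually_lt (s := 0) hK₁.2.le hmK hTm0 fun h0 => by
      have := Real.logb_lt_logb one_lt_two h0 key
      linarith
    simpa using this
  have hmax : ∀ᶠ P in atTop, |(I K m P).toReal - maxRate σ₁ σ₂ c K P| < ε / 2 := by
    filter_upwards [h.eventually_abs_lt hmK hTm0 hlm, eventually_gt_atTop 0] with P h1 hP
    rw [maxRate_eq hσ₁ hσ₂ hc (by omega) hP]
    linarith
  have hsplit : ∀ K₁ ∈ Finset.range (K + 1), ε * K ≤ K₁ → (K₁ : ℝ) ≤ (1 - ε) * K →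
      ∀ᶠ P in atTop, |(I K K₁ P).toReal - splitRate σ₁ σ₂ c K K₁ P| ≤ ε := by
    intro K₁ hK₁ h1 h2
    have hK₁K : K₁ ≤ K := by rw [Finset.mem_range] at hK₁; omega
    have h3 : (ε * K) * (ε * K) ≤ (K₁ : ℝ) * (K - K₁) := by
      have : 0 < ε * K := by positivity
      gcongr
      linarith
    have h4 : 0 < (K₁ : ℝ) * (K - K₁) := lt_of_lt_of_le (by positivity) h3
    have h5 : |T K K₁ - K₁ * (K - K₁) * c| ≤ κ * ((K₁ : ℝ) * (K - K₁) * c) := by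
      have := hK K₁ hK₁K
      rw [mul_comm c] at this
      refine this.trans ?_
      have h6 : κ * c * ((ε * K) * (ε * K)) ≤ κ * c * ((K₁ : ℝ) * (K - K₁)) := by gcongr
      have h7 : 4 * δ * (K : ℝ) ^ 2 ≤ κ * (c * ε ^ 2) * (K : ℝ) ^ 2 := by gcongr
      have h8 : 0 < δ * (K : ℝ) ^ 2 := by positivity
      nlinarith
    have h6 : 0 < T K K₁ := by
      have h7 := (abs_le.1 h5).1
      have h8 : κ * ((K₁ : ℝ) * (K - K₁) * c) < 1 * ((K₁ : ℝ) * (K - K₁) * c) := by gcongr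
      linarith
    filter_upwards [h.eventually_abs_lt hK₁K h6 (hκ _ _ (by positivity) h5),
      eventually_gt_atTop 0] with P h7 hP
    rw [splitRate_eq hσ₁ hσ₂ (by positivity) hP]
    linarith
  filter_upwards [(Finset.eventually_all (Finset.Ico 1 K)).2 hcmp,
    (Finset.eventually_all (Finset.Ico 1 K)).2 fun K₁ hK₁ => eventually_imp_distrib_left.2
      (hstrict K₁ hK₁), hmax,
    (Finset.eventually_all (Finset.range (K + 1))).2 fun K₁ hK₁ => eventually_imp_distrib_left.2
      fun h1 => eventually_imp_distrib_left.2 (hsplit K₁ hK₁ h1),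
    eventually_gt_atTop 0] with P q1 q2 q3 q4 hP
  have q2' : ∀ K₁ ∈ Finset.Ico 1 K, ε < |(K₁ : ℝ) / K - 1 / 2| → I K K₁ P < I K m P :=
    fun K₁ hK₁ hfar => (ENNReal.toReal_lt_toReal (h.ne_top _ _ _ hP) (h.ne_top _ _ _ hP)).1
      (q2 K₁ hK₁ hfar)
  refine ⟨fun K₁ _ => h.ne_top _ _ _ hP, fun K₁ hK₁ => ?_, q2', ?_, ?_, ?_⟩
  · linarith [q1 K₁ hK₁]
  · linarith
  · rintro K₁ ⟨hK₁, hopt⟩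
    have hle : I K m P ≤ I K K₁ P := hopt m hmI
    refine ⟨?_, ?_⟩
    · by_contra hfar
      exact absurd (q2' K₁ hK₁ (not_le.1 hfar)) (not_lt.2 hle)
    · have h1 := ENNReal.toReal_mono (h.ne_top K K₁ P hP) hle
      have h2 := q1 K₁ hK₁
      rw [abs_lt] at q3
      rw [abs_le]
      constructor <;> linarith
  · intro K₁ h1 h2
    refine q4 K₁ ?_ h1 h2
    have : (K₁ : ℝ) ≤ K := by nlinarith
    have : K₁ ≤ K := by exact_mod_cast this
    rw [Finset.mem_range]
    omega

theorem HighSNRExpansion.halfSplitExact {σ₁ σ₂ c : ℝ} (hσ₁ : 0 < σ₁) (hσ₂ : 0 < σ₂)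
    (hc : 0 < c) {I : ℕ → ℕ → ℝ → ℝ≥0∞} {T : ℕ → ℕ → ℝ}
    (h : HighSNRExpansion I (baseRate σ₁ σ₂) T)
    (hT : ∀ K K₁ : ℕ, K₁ ≤ K → T K K₁ = c * (K₁ * (K - K₁))) :
    HalfSplitExact σ₁ σ₂ c I := by
  intro K hK2
  set m := K / 2 with hm
  have hmK : m ≤ K := Nat.div_le_self _ _
  have hmI : m ∈ Finset.Ico 1 K := by rw [Finset.mem_Ico]; omega
  have hTm0 : 0 < T K m := by
    rw [hT K m hmK]
    have h1 : (0 : ℝ) < m := by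
      have : 0 < m := by omega
      exact_mod_cast this
    have h2 : (0 : ℝ) < (K : ℝ) - m := by
      have : m < K := by omega
      have : (m : ℝ) < K := by exact_mod_cast this
      linarith
    positivity
  constructor
  · have hstrict : ∀ K₁ ∈ Finset.Ico 1 K, ¬ (K₁ = K / 2 ∨ K₁ = (K + 1) / 2) → ∀ᶠ P in atTop,
        (I K K₁ P).toReal < (I K m P).toReal := by
      intro K₁ hK₁ hne
      rw [Finset.mem_Ico] at hK₁
      have key : T K K₁ < T K m := by
        rw [hT K m hmK, hT K K₁ hK₁.2.le]
        refine mul_lt_mul_of_pos_left ?_ hc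
        have hm2 : K = 2 * m ∨ K = 2 * m + 1 := by omega
        -- The upper rounding (K + 1)/2 equals K − m, so the excluded K₁ lie strictly outside [m, K
        -- − m], where the integer product is strictly smaller.
        have h3 : (K₁ : ℤ) + 1 ≤ m ∨ (K : ℤ) - m + 1 ≤ K₁ := by omega
        have : (K₁ : ℤ) * (K - K₁) < m * (K - m) := by
          have : 2 * (m : ℤ) ≤ K := by omega
          rcases h3 with h3 | h3 <;> nlinarith
        exact_mod_cast this
      have := h.eventually_lt (s := 0) hK₁.2.le hmK hTm0 fun h0 => by
        have := Real.logb_lt_logb one_lt_two h0 key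
        linarith
      simpa using this
    filter_upwards [(Finset.eventually_all (Finset.Ico 1 K)).2 fun K₁ hK₁ =>
      eventually_imp_distrib_left.2 (hstrict K₁ hK₁), eventually_gt_atTop 0] with P q hP
    rintro K₁ ⟨hK₁, hopt⟩
    by_contra hne
    exact absurd (q K₁ hK₁ hne) (not_lt.2 (ENNReal.toReal_mono (h.ne_top _ _ _ hP) (hopt m hmI)))
  · intro hev
    have hlim := (h.tendsto K m hmK hTm0).sub_const (Real.logb 2 (T K m) / 2)
    rw [sub_self] at hlim
    refine hlim.congr' ?_
    filter_upwards [eventually_gt_atTop 0] with P hP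
    have e : T K m = c / 4 * (K : ℝ) ^ 2 := by
      have : K = 2 * m := by obtain ⟨k, hk⟩ := hev; omega
      have : (K : ℝ) = 2 * m := by exact_mod_cast this
      rw [hT K m hmK, this]
      ring
    rw [maxRate_eq hσ₁ hσ₂ hc (by omega) hP, e]
    ring

/-- Convergence of averages is uniform at scale K: large n have error at most δn ≤ δK, and the
finitely many small n have a fixed total error, absorbed once K is large. -/
theorem eventually_forall_abs_sub_le {S : ℕ → ℝ} {a : ℝ}
    (h : Tendsto (fun n : ℕ => S n / n) atTop (𝓝 a)) (h0 : S 0 = 0) {δ : ℝ} (hδ : 0 < δ) :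
    ∀ᶠ K : ℕ in atTop, ∀ n ≤ K, |S n - a * n| ≤ δ * K := by
  obtain ⟨n₀, hn₀⟩ := eventually_atTop.1 (Metric.tendsto_nhds.1 h δ hδ)
  obtain ⟨C, hC⟩ := exists_nat_ge ((∑ n ∈ Finset.range n₀, |S n - a * n|) / δ)
  filter_upwards [eventually_ge_atTop C] with K hK n hn
  have hnK : (n : ℝ) ≤ K := by exact_mod_cast hn
  rcases lt_or_ge n n₀ with hlt | hge
  · have h1 : |S n - a * n| ≤ ∑ n ∈ Finset.range n₀, |S n - a * n| :=
      Finset.single_le_sum (f := fun n : ℕ => |S n - a * n|) (fun _ _ => abs_nonneg _)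
        (Finset.mem_range.2 hlt)
    rw [div_le_iff₀ hδ] at hC
    have h2 : (C : ℝ) ≤ K := by exact_mod_cast hK
    nlinarith
  -- At n = 0 the average is 0/0 = 0 and carries no information, hence the separate assumption S 0 =
  -- 0.
  · rcases Nat.eq_zero_or_pos n with rfl | hpos
    · simp [h0]; positivity
    have hn0 : (0 : ℝ) < n := by exact_mod_cast hpos
    have h1 := hn₀ n hge
    rw [Real.dist_eq] at h1
    have h2 : S n - a * n = (S n / n - a) * n := by field_simp
    rw [h2, abs_mul, abs_of_pos hn0]
    nlinarith [abs_nonneg (S n / n - a)]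

theorem eventually_abs_mul_sub_le {S U : ℕ → ℝ} {a b : ℝ} (ha : 0 ≤ a) (hb : 0 ≤ b)
    (hS : Tendsto (fun n : ℕ => S n / n) atTop (𝓝 a)) (hS0 : S 0 = 0)
    (hU : Tendsto (fun n : ℕ => U n / n) atTop (𝓝 b)) (hU0 : U 0 = 0) {δ : ℝ} (hδ : 0 < δ) :
    ∀ᶠ K : ℕ in atTop, ∀ K₁ ≤ K,
      |S K₁ * (U K - U K₁) - a * b * (K₁ * (K - K₁))| ≤ δ * (K : ℝ) ^ 2 := by
  -- b and 2a weigh the errors linear in S and in the increment of U; 2 weighs their product, made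
  -- linear in η by η ≤ 1.
  obtain ⟨η, hη, hη1, hηδ⟩ : ∃ η : ℝ, 0 < η ∧ η ≤ 1 ∧ η * (b + 2 * a + 2) ≤ δ := by
    refine ⟨min 1 (δ / (b + 2 * a + 2)), by positivity, min_le_left _ _, ?_⟩
    rw [← le_div_iff₀ (by positivity)]
    exact min_le_right _ _
  filter_upwards [eventually_forall_abs_sub_le hS hS0 hη,
    eventually_forall_abs_sub_le hU hU0 hη] with K h1 h2 K₁ hK₁
  have hk : (K₁ : ℝ) ≤ K := by exact_mod_cast hK₁
  have hk0 : (0 : ℝ) ≤ K₁ := by positivity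
  have hK0 : (0 : ℝ) ≤ K := by positivity
  have e : S K₁ * (U K - U K₁) - a * b * (K₁ * (K - K₁))
      = (S K₁ - a * K₁) * (b * (K - K₁)) + (a * K₁) * ((U K - b * K) - (U K₁ - b * K₁))
        + (S K₁ - a * K₁) * ((U K - b * K) - (U K₁ - b * K₁)) := by ring
  have hu : |(U K - b * K) - (U K₁ - b * K₁)| ≤ 2 * (η * K) :=
    (abs_sub _ _).trans (by linarith [h2 K le_rfl, h2 K₁ hK₁])
  have hs := h1 K₁ hK₁
  have hd : |(K : ℝ) - K₁| ≤ K := by rw [abs_le]; constructor <;> linarith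
  rw [e]
  calc _ ≤ |S K₁ - a * K₁| * (b * |(K : ℝ) - K₁|)
        + (a * K₁) * |(U K - b * K) - (U K₁ - b * K₁)|
        + |S K₁ - a * K₁| * |(U K - b * K) - (U K₁ - b * K₁)| := by
        refine (abs_add_three _ _ _).trans (le_of_eq ?_)
        simp only [abs_mul, abs_of_nonneg ha, abs_of_nonneg hb, abs_of_nonneg hk0]
    _ ≤ (η * K) * (b * K) + (a * K) * (2 * (η * K)) + (η * K) * (2 * (1 * K)) := by
        have : 2 * (η * K) ≤ 2 * (1 * K) := by gcongr
        have h3 : |(U K - b * K) - (U K₁ - b * K₁)| ≤ 2 * (1 * K) := hu.trans this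
        gcongr
    _ = η * (b + 2 * a + 2) * (K : ℝ) ^ 2 := by ring
    _ ≤ _ := by gcongr

end HalfSplit

/-! ### The simplified receiver for a fixed channel realization. -/

section SimplifiedReceiver

theorem theta1_simplifiedRatio (h : ℕ → ℂ) {K K₁ : ℕ} (hK : K₁ ≤ K) :
    theta1 (simplifiedRatio K K₁) (fun k : Fin K => h k)
      = ∑ k ∈ Finset.range K₁, ‖h k‖ ^ 2 := by
  simp only [theta1, simplifiedRatio]
  rw [Fin.sum_univ_eq_sum_range (fun k => (if k < K₁ then (1 : ℝ) else 0) * ‖h k‖ ^ 2) K,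
    ← Finset.sum_range_add_sum_Ico _ hK, Finset.sum_eq_zero (s := Finset.Ico K₁ K), add_zero]
  · exact Finset.sum_congr rfl fun k hk => by simp [Finset.mem_range.1 hk]
  · intro k hk
    simp [not_lt.2 (Finset.mem_Ico.1 hk).1]

theorem theta2_simplifiedRatio (h : ℕ → ℂ) {K K₁ : ℕ} (hK : K₁ ≤ K) :
    theta2 (simplifiedRatio K K₁) (fun k : Fin K => h k)
      = ∑ k ∈ Finset.range K, ‖h k‖ ^ 4 - ∑ k ∈ Finset.range K₁, ‖h k‖ ^ 4 := by
  simp only [theta2, simplifiedRatio]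
  rw [Fin.sum_univ_eq_sum_range (fun k => (1 - if k < K₁ then (1 : ℝ) else 0) ^ 2 * ‖h k‖ ^ 4) K,
    ← Finset.sum_range_add_sum_Ico _ hK, Finset.sum_eq_zero (s := Finset.range K₁), zero_add,
    ← Finset.sum_range_add_sum_Ico (fun k => ‖h k‖ ^ 4) hK, add_sub_cancel_left]
  · exact Finset.sum_congr rfl fun k hk => by simp [not_lt.2 (Finset.mem_Ico.1 hk).1]
  · intro k hk
    simp [Finset.mem_range.1 hk]

theorem theta1_simplifiedRatio_nonneg {K : ℕ} (K₁ : ℕ) (h : Fin K → ℂ) :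
    0 ≤ theta1 (simplifiedRatio K K₁) h := by
  refine Finset.sum_nonneg fun k _ => mul_nonneg ?_ (by positivity)
  unfold simplifiedRatio
  split_ifs <;> norm_num

theorem theta2_nonneg {K : ℕ} (ρ : Fin K → ℝ) (h : Fin K → ℂ) : 0 ≤ theta2 ρ h :=
  Finset.sum_nonneg fun k _ => by positivity

variable {Ω' : Type*} [MeasurableSpace Ω'] {Q : Measure Ω'} [IsProbabilityMeasure Q]
  {X Z : Ω' → ℂ} {N : Ω' → ℝ} {σ₁ σ₂ : ℝ≥0}

/-- T is the product Θ₁Θ₂ in partial sums. It may vanish even for 1 ≤ K₁ < K, when all coefficients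
of one branch are 0, which is why the −∞ case is kept. -/
theorem highSNRExpansion_simplifiedMI (hσ₁ : 0 < σ₁) (hσ₂ : 0 < σ₂)
    (hX : HasLaw X (complexGaussian 1) Q) (hZ : HasLaw Z (complexGaussian (σ₁ ^ 2)) Q)
    (hN : HasLaw N (gaussianReal 0 (σ₂ ^ 2)) Q) (hZN : IndepFun Z N Q)
    (hXZN : IndepFun X (fun ω => (Z ω, N ω)) Q) (h : ℕ → ℂ) :
    HighSNRExpansion (simplifiedMI Q X Z N h) (baseRate σ₁ σ₂)
      (fun K K₁ => (∑ k ∈ Finset.range K₁, ‖h k‖ ^ 2)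
        * (∑ k ∈ Finset.range K, ‖h k‖ ^ 4 - ∑ k ∈ Finset.range K₁, ‖h k‖ ^ 4)) := by
  have hl2 : 0 < Real.log 2 := Real.log_pos one_lt_two
  have hMI (K K₁ : ℕ) {P : ℝ} (hP : 0 < P) : simplifiedMI Q X Z N h K K₁ P = _ :=
    splittingMI_eq_channelInfo Q hX hZ hN hZN hXZN hP (simplifiedRatio K K₁) (fun k : Fin K => h k)
  have hev (K K₁ : ℕ) : ∀ᶠ P : ℝ in atTop,
      simplifiedMI Q X Z N h K K₁ P = channelInfo σ₁ σ₂
        (√(theta1 (simplifiedRatio K K₁) (fun k : Fin K => h k)) * √P)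
        (√(theta2 (simplifiedRatio K K₁) (fun k : Fin K => h k)) * P)
        / ENNReal.ofReal (Real.log 2) :=
    (eventually_gt_atTop 0).mono fun P hP => hMI K K₁ hP
  have h1 (K K₁ : ℕ) := theta1_simplifiedRatio_nonneg K₁ (fun k : Fin K => h k)
  have h2 (K K₁ : ℕ) := theta2_nonneg (simplifiedRatio K K₁) (fun k : Fin K => h k)
  refine ⟨fun K K₁ P hP => ?_, fun K K₁ hK => ?_, fun K K₁ hK hT => ?_, fun K K₁ hK hT => ?_⟩
  · rw [hMI K K₁ hP]
    exact ENNReal.div_ne_top (channelInfo_ne_top hσ₁ hσ₂ _ _) (by simpa using hl2)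
  · rw [← theta1_simplifiedRatio h hK, ← theta2_simplifiedRatio h hK]
    exact mul_nonneg (h1 K K₁) (h2 K K₁)
  · rw [← theta1_simplifiedRatio h hK, ← theta2_simplifiedRatio h hK] at hT ⊢
    refine (tendsto_bits_sub_baseRate hσ₁ hσ₂ (h1 K K₁) (h2 K K₁) hT).congr' ?_
    filter_upwards [hev K K₁] with P hP
    rw [hP]
  · rw [← theta1_simplifiedRatio h hK, ← theta2_simplifiedRatio h hK] at hT
    refine (tendsto_bits_sub_baseRate_atBot hσ₁ hσ₂ (h1 K K₁) (h2 K K₁) hT).congr' ?_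
    filter_upwards [hev K K₁] with P hP
    rw [hP]

/-- A statement about one realization: the only input from the channel is convergence of the two
empirical moments. -/
theorem halfSplitOptimal_simplifiedMI (hσ₁ : 0 < σ₁) (hσ₂ : 0 < σ₂)
    (hX : HasLaw X (complexGaussian 1) Q) (hZ : HasLaw Z (complexGaussian (σ₁ ^ 2)) Q)
    (hN : HasLaw N (gaussianReal 0 (σ₂ ^ 2)) Q) (hZN : IndepFun Z N Q)
    (hXZN : IndepFun X (fun ω => (Z ω, N ω)) Q) {h : ℕ → ℂ} {a b : ℝ} (ha : 0 < a) (hb : 0 < b)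
    (h2 : Tendsto (fun n : ℕ => (∑ k ∈ Finset.range n, ‖h k‖ ^ 2) / n) atTop (𝓝 a))
    (h4 : Tendsto (fun n : ℕ => (∑ k ∈ Finset.range n, ‖h k‖ ^ 4) / n) atTop (𝓝 b)) :
    HalfSplitOptimal σ₁ σ₂ (a * b) (simplifiedMI Q X Z N h) :=
  (highSNRExpansion_simplifiedMI hσ₁ hσ₂ hX hZ hN hZN hXZN h).halfSplitOptimal
    (NNReal.coe_pos.2 hσ₁) (NNReal.coe_pos.2 hσ₂) (mul_pos ha hb)
    fun _ hδ => eventually_abs_mul_sub_le ha.le hb.le h2 (by simp) h4 (by simp) hδ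

theorem halfSplit_simplifiedMI_of_norm_eq (hσ₁ : 0 < σ₁) (hσ₂ : 0 < σ₂)
    (hX : HasLaw X (complexGaussian 1) Q) (hZ : HasLaw Z (complexGaussian (σ₁ ^ 2)) Q)
    (hN : HasLaw N (gaussianReal 0 (σ₂ ^ 2)) Q) (hZN : IndepFun Z N Q)
    (hXZN : IndepFun X (fun ω => (Z ω, N ω)) Q) {h : ℕ → ℂ} {r : ℝ} (hr : 0 < r)
    (hnorm : ∀ k, ‖h k‖ = r) :
    HalfSplitOptimal σ₁ σ₂ (r ^ 2 * r ^ 4) (simplifiedMI Q X Z N h) ∧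
      HalfSplitExact σ₁ σ₂ (r ^ 2 * r ^ 4) (simplifiedMI Q X Z N h) := by
  have hlim (p : ℕ) : Tendsto (fun n : ℕ => (∑ k ∈ Finset.range n, ‖h k‖ ^ p) / n) atTop
      (𝓝 (r ^ p)) := by
    refine tendsto_const_nhds.congr' ?_
    filter_upwards [eventually_gt_atTop 0] with n hn
    have : (n : ℝ) ≠ 0 := by exact_mod_cast hn.ne'
    simp only [hnorm, Finset.sum_const, Finset.card_range, nsmul_eq_mul]
    field_simp
  refine ⟨halfSplitOptimal_simplifiedMI hσ₁ hσ₂ hX hZ hN hZN hXZN (by positivity) (by positivity)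
    (hlim 2) (hlim 4), ?_⟩
  refine (highSNRExpansion_simplifiedMI hσ₁ hσ₂ hX hZ hN hZN hXZN h).halfSplitExact
    (NNReal.coe_pos.2 hσ₁) (NNReal.coe_pos.2 hσ₂) (by positivity) fun K K₁ _ => ?_
  simp only [hnorm, Finset.sum_const, Finset.card_range, nsmul_eq_mul]
  ring

end SimplifiedReceiver

/-! ### Strong law for the channel gains, and the main statement. -/

section RandomChannel

variable {Ω : Type*} [MeasurableSpace Ω] {μ : Measure Ω}

theorem integral_norm_pow_pos {f : Ω → ℂ} (hf : ¬ (f =ᵐ[μ] 0)) {p : ℕ}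
    (hp : p ≠ 0) (hi : Integrable (fun ω => ‖f ω‖ ^ p) μ) : 0 < ∫ ω, ‖f ω‖ ^ p ∂μ := by
  refine lt_of_le_of_ne (integral_nonneg fun _ => by positivity) fun h0 => hf ?_
  have := (integral_eq_zero_iff_of_nonneg (fun _ => by positivity) hi).1 h0.symm
  filter_upwards [this] with ω hω
  simpa [hp] using hω

theorem ae_tendsto_average_norm_pow {h : ℕ → Ω → ℂ} (hind : iIndepFun h μ)
    (hid : ∀ k, IdentDistrib (h k) (h 0) μ μ) {p : ℕ}
    (hi : Integrable (fun ω => ‖h 0 ω‖ ^ p) μ) :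
    ∀ᵐ ω ∂μ, Tendsto (fun n : ℕ => (∑ k ∈ Finset.range n, ‖h k ω‖ ^ p) / n) atTop
      (𝓝 (∫ ω', ‖h 0 ω'‖ ^ p ∂μ)) := by
  have hm : Measurable fun x : ℂ => ‖x‖ ^ p := by fun_prop
  exact strong_law_ae_real (fun k ω => ‖h k ω‖ ^ p) hi
    (fun i j hij => (hind.indepFun hij).comp hm hm) fun k => (hid k).comp hm

end RandomChannel

theorem four_mul_split_le {K K₁ : ℕ} (h : K₁ < K) :
    4 * (K₁ * (K - K₁)) ≤ K ^ 2 ∧ (4 * (K₁ * (K - K₁)) = K ^ 2 ↔ 2 * K₁ = K) := by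
  -- Here K − K₁ = d + 1, which removes the truncated subtraction; the claim is then (K₁ − (d + 1))²
  -- ≥ 0 with its equality case.
  obtain ⟨d, rfl⟩ := Nat.exists_eq_add_of_lt h
  rw [show K₁ + d + 1 - K₁ = d + 1 by omega]
  zify
  refine ⟨by nlinarith [sq_nonneg ((K₁ : ℤ) - (d + 1))], fun he => ?_, fun he => ?_⟩
  · have : ((K₁ : ℤ) - (d + 1)) ^ 2 = 0 := by linear_combination -he
    have := pow_eq_zero_iff two_ne_zero |>.1 this
    linarith
  · have : (d : ℤ) = K₁ - 1 := by linarith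
    rw [this]
    ring

end SplittingReceiver

end

theorem proposition2
    {Ω' : Type*} [MeasurableSpace Ω'] (Q : Measure Ω') [IsProbabilityMeasure Q]
    (X Z : Ω' → ℂ) (N : Ω' → ℝ) (σ₁ σ₂ : ℝ≥0) (hσ₁ : 0 < σ₁) (hσ₂ : 0 < σ₂)
    (hX : HasLaw X (complexGaussian 1) Q)
    (hZ : HasLaw Z (complexGaussian (σ₁ ^ 2)) Q)
    (hN : HasLaw N (gaussianReal 0 (σ₂ ^ 2)) Q)
    (hZN : IndepFun Z N Q)
    (hXZN : IndepFun X (fun ω => (Z ω, N ω)) Q)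
    {Ω : Type*} [MeasurableSpace Ω] (μ : Measure Ω) [IsProbabilityMeasure μ]
    (h : ℕ → Ω → ℂ) :
    -- `K₁ K₂` is maximal exactly at `K₁ = K / 2`
    (∀ K K₁ : ℕ, 1 ≤ K₁ → K₁ < K →
      4 * (K₁ * (K - K₁)) ≤ K ^ 2 ∧ (4 * (K₁ * (K - K₁)) = K ^ 2 ↔ 2 * K₁ = K)) ∧
    -- spatially uncorrelated channel: i.i.d. coefficients
    (iIndepFun h μ → (∀ k, IdentDistrib (h k) (h 0) μ μ) → MemLp (h 0) 4 μ → ¬ (h 0 =ᵐ[μ] 0) →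
      ∀ᵐ ω ∂μ, HalfSplitOptimal σ₁ σ₂ ((∫ ω', ‖h 0 ω'‖ ^ 2 ∂μ) * ∫ ω', ‖h 0 ω'‖ ^ 4 ∂μ)
        (simplifiedMI Q X Z N (fun k => h k ω))) ∧
    -- fully correlated channel: equal (possibly random) magnitudes at all antennas
    ((∀ k, ∀ᵐ ω ∂μ, ‖h k ω‖ = ‖h 0 ω‖) → (∀ᵐ ω ∂μ, h 0 ω ≠ 0) →
      ∀ᵐ ω ∂μ,
        HalfSplitOptimal σ₁ σ₂ (‖h 0 ω‖ ^ 2 * ‖h 0 ω‖ ^ 4)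
          (simplifiedMI Q X Z N (fun k => h k ω)) ∧
        HalfSplitExact σ₁ σ₂ (‖h 0 ω‖ ^ 2 * ‖h 0 ω‖ ^ 4)
          (simplifiedMI Q X Z N (fun k => h k ω))) ∧
    -- free space: the common magnitude is deterministic
    (∀ a : ℝ, 0 < a → (∀ k, ∀ᵐ ω ∂μ, ‖h k ω‖ = a) →
      ∀ᵐ ω ∂μ,
        HalfSplitOptimal σ₁ σ₂ ((∫ ω', ‖h 0 ω'‖ ^ 2 ∂μ) * ∫ ω', ‖h 0 ω'‖ ^ 4 ∂μ)
          (simplifiedMI Q X Z N (fun k => h k ω)) ∧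
        HalfSplitExact σ₁ σ₂ ((∫ ω', ‖h 0 ω'‖ ^ 2 ∂μ) * ∫ ω', ‖h 0 ω'‖ ^ 4 ∂μ)
          (simplifiedMI Q X Z N (fun k => h k ω))) := by
  refine ⟨fun K K₁ _ h => four_mul_split_le h, fun hind hid hLp h0 => ?_, fun hnorm hne => ?_,
    fun a ha hnorm => ?_⟩
  · have i4 : Integrable (fun ω => ‖h 0 ω‖ ^ 4) μ := by
      simpa using hLp.integrable_norm_pow (by norm_num : (4 : ℕ) ≠ 0)
    -- On a probability space the fourth moment controls the second.
    have i2 : Integrable (fun ω => ‖h 0 ω‖ ^ 2) μ :=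
      (hLp.mono_exponent (by norm_num : (2 : ℝ≥0∞) ≤ 4)).integrable_norm_pow two_ne_zero
    filter_upwards [ae_tendsto_average_norm_pow hind hid i2,
      ae_tendsto_average_norm_pow hind hid i4] with ω h2 h4
    exact halfSplitOptimal_simplifiedMI hσ₁ hσ₂ hX hZ hN hZN hXZN
      (integral_norm_pow_pos h0 two_ne_zero i2) (integral_norm_pow_pos h0 four_ne_zero i4) h2 h4
  · filter_upwards [ae_all_iff.2 hnorm, hne] with ω h1 h2
    exact halfSplit_simplifiedMI_of_norm_eq hσ₁ hσ₂ hX hZ hN hZN hXZN (norm_pos_iff.2 h2) h1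
  · have e (p : ℕ) : ∫ ω', ‖h 0 ω'‖ ^ p ∂μ = a ^ p := by
      rw [integral_congr_ae (g := fun _ => a ^ p) ((hnorm 0).mono fun ω hω => by simp only [hω])]
      simp
    rw [e 2, e 4]
    filter_upwards [ae_all_iff.2 hnorm] with ω h1
    exact halfSplit_simplifiedMI_of_norm_eq hσ₁ hσ₂ hX hZ hN hZN hXZN ha h1
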